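/- Let $\mathbb S$ be a finite set, $\gamma\in(0,1)$, $P\in\mathbb R^{\mathbb S\times\mathbb S}$ a row-stochastic matrix with rows $p_i^\top$, and $M\in\mathbb R^{\mathbb S\times\mathbb S}$ a symmetric positive definite matrix. For each $i\in\mathbb S$ let $\nu_i$ be a probability law on $\mathbb R$ with finite second moment (the law of an observed reward at state $i$) and let $b_i$ be its mean. Put $A=I-\gamma P$, $v=A^{-1}b$ and $\|x\|_M^2=x^\top A^\top MAx$. For $n\ge 1$ let $\hat P$ and $\hat b$ be estimates of $P$ and $b$ from $n$ samples per state: $\hat P_{ij}=X_{ij}/n$, where the rows $X_i$ are independent and $X_i$ is multinomial with $n$ trials and cell probabilities $p_i$; $\hat b_i$ is the average of $n$ independent observed rewards with law $\nu_i$ (rewards at different states may be correlated); and $\hat P$ is independent of $\hat b$. Put $\hat A=I-\gamma\hat P$, $\hat v=\hat A^{-1}\hat b$, $\hat Y=(A-\hat A)A^{-1}$ and $$\mathrm{MSE}(\varepsilon)=\mathbb E\,\|v-\varepsilon\hat v\|_M^2,\qquad \varepsilon^*=\frac{\mathbb E[b^\top MA\hat v]}{\mathbb E[\hat v^\top A^\top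 MA\hat v]} .$$ Let $B_i=\frac1n(\mathrm{diag}(p_i)-p_ip_i^\top)$, $$G=\gamma^2A^{-\top}\Big(\sum_i M_{ii}B_i\Big)A^{-1},$$ $$H=\gamma^2\Big[\sum_iA^{-\top}B_iA^{-1}\mathrm{diag}(e_i)\Big]M+\gamma^2M\Big[\sum_i\mathrm{diag}(e_i)A^{-\top}B_iA^{-1}\Big],$$ $g=b^\top Gb$, $h=b^\top Hb$, $t=\mathrm{tr}\big(\mathrm{cov}[\hat b](M+G+H)\big)$, and $$\varepsilon^\circ=\frac{b^\top(M+H/2)b}{b^\top(M+G+H)b+\mathrm{tr}\big(\mathrm{cov}[\hat b](M+G+H)\big)} .$$ (A quotient $0/0$, possible only when $b=0$, is read as $0$.) Then there are $C$ and $n_0$, depending only on $\gamma,P,M$ and the laws $\nu_i$, such that for all $n\ge n_0$: 1. $G=\mathbb E[\hat Y^\top M\hat Y]$ and $H=\mathbb E[(\hat Y^\top)^2M+M\hat Y^2]$. 2. For every $\varepsilon\in\mathbb R$ the loss $\|v-\varepsilon\hat v\|_M^2$ is integrable, and $$\mathrm{MSE}(\varepsilon)=(1-\varepsilon)^2\,b^\top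 Mb+(g+h+t)\varepsilon^2-h\varepsilon+r_n(\varepsilon),\qquad |r_n(\varepsilon)|\le C(1+\varepsilon^2)n^{-3/2}.$$ 3. $\varepsilon^*$ minimizes $\mathrm{MSE}$ over $\mathbb R$. If $b\neq0$, it is the unique minimizer and the denominator of $\varepsilon^\circ$ is positive. Moreover $|\varepsilon^*-\varepsilon^\circ|\le Cn^{-3/2}$. 4. $\varepsilon^\circ$ is asymptotically as good as the optimal factor: $\mathrm{MSE}(\varepsilon^\circ)\le\mathrm{MSE}(\varepsilon^*)+Cn^{-3}$. -/

import Mathlib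

open MeasureTheory ProbabilityTheory Matrix

universe u v

namespace OperatorAugmentation

noncomputable section

variable {S : Type u} [Fintype S] [DecidableEq S]

/-! ### The system `(I - γ P) v = b` -/

/-- The matrix `A = I - γ P`. With `P` replaced by the estimate this is also `Â = I - γ P̂`. -/
def sysMat (γ : ℝ) (P : Matrix S S ℝ) : Matrix S S ℝ := 1 - γ • P

/-- For a row-stochastic `P` and `0 < γ < 1` the matrix `I - γ P` is invertible, so the inverses
used below are genuine. -/
theorem isUnit_det_sysMat {γ : ℝ} (hγ0 : 0 < γ) (hγ1 : γ < 1) {P : Matrix S S ℝ}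
    (hP : P ∈ Matrix.rowStochastic ℝ S) : IsUnit (sysMat γ P).det := by
  rw [isUnit_iff_ne_zero]
  apply det_ne_zero_of_sum_row_lt_diag
  intro i
  have h0 : ∀ j, 0 ≤ P i j := fun j => hP.1 i j
  have h1 : ∑ j, P i j = 1 := by
    have := congrFun hP.2 i
    simpa [Matrix.mulVec, dotProduct] using this
  have h2 : ∑ j ∈ Finset.univ.erase i, P i j = 1 - P i i := by
    rw [← h1, ← Finset.add_sum_erase _ _ (Finset.mem_univ i)]; ring
  have h3 : 0 ≤ 1 - P i i := by
    rw [← h2]; exact Finset.sum_nonneg fun j _ => h0 j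
  have h4 : ∑ j ∈ Finset.univ.erase i, ‖sysMat γ P i j‖ = γ * (1 - P i i) := by
    rw [← h2, Finset.mul_sum]
    refine Finset.sum_congr rfl fun j hj => ?_
    have hij : i ≠ j := (Finset.ne_of_mem_erase hj).symm
    simp [sysMat, Matrix.one_apply_ne hij, abs_of_pos hγ0, abs_of_nonneg (h0 j)]
  have h5 : sysMat γ P i i = 1 - γ * P i i := by simp [sysMat]
  rw [h4, h5]
  refine lt_of_lt_of_le ?_ (Real.le_norm_self _)
  nlinarith

/-- The solution `(I - γ P)⁻¹ b` of `(I - γ P) v = b`: the value function `v` for the true pair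
`(P, b)`, the naive estimate `v̂` for the estimated pair `(P̂, b̂)`. -/
def valueFn (γ : ℝ) (P : Matrix S S ℝ) (b : S → ℝ) : S → ℝ := (sysMat γ P)⁻¹ *ᵥ b

/-- The value function solves `(I - γ P) v = b`. -/
theorem sysMat_mulVec_valueFn {γ : ℝ} (hγ0 : 0 < γ) (hγ1 : γ < 1) {P : Matrix S S ℝ}
    (hP : P ∈ Matrix.rowStochastic ℝ S) (b : S → ℝ) :
    sysMat γ P *ᵥ valueFn γ P b = b := by
  rw [valueFn, Matrix.mulVec_mulVec, Matrix.mul_nonsing_inv _ (isUnit_det_sysMat hγ0 hγ1 hP),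
    Matrix.one_mulVec]

/-- The squared generalized residual norm `‖x‖²_M = xᵀ Aᵀ M A x`. -/
def sqNorm (γ : ℝ) (P M : Matrix S S ℝ) (x : S → ℝ) : ℝ :=
  x ⬝ᵥ (((sysMat γ P)ᵀ * M * sysMat γ P) *ᵥ x)

/-! ### The sampling model -/

/-- The multinomial distribution with `n` trials and cell probabilities `p`: the law of the vector
of cell counts of `n` independent draws from the finite set `S`, each equal to `j` with
probability `p j`. -/
def multinomialLaw (n : ℕ) (p : S → ℝ) : Measure (S → ℕ) :=
  ∑ f : Fin n → S, ENNReal.ofReal (∏ k, p (f k)) •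
    Measure.dirac (fun j => (Finset.univ.filter fun k => f k = j).card)

/-- The expected reward vector `b`, where `ν i` is the law of one observed reward at state `i`
(for a policy `π` and rewards `r`: the law of `r i a` when the action `a` is drawn from `π i`). -/
def meanReward (ν : S → Measure ℝ) : S → ℝ := fun i => ∫ x, x ∂(ν i)

variable {Ω : Type v} [MeasurableSpace Ω]

/-- The estimated transition matrix: `X ω i j` is the number of observed transitions from `i` to
`j`, and `P̂ i j = X i j / n`. -/
def estP (n : ℕ) (X : Ω → S → S → ℕ) (ω : Ω) : Matrix S S ℝ :=
  Matrix.of fun i j => (X ω i j : ℝ) / n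

/-- The estimated reward vector: `b̂ i` is the average of the `n` rewards observed at `i`. -/
def estB (n : ℕ) (R : S → Fin n → Ω → ℝ) (ω : Ω) : S → ℝ :=
  fun i => (∑ k, R i k ω) / n

/-- The sampling assumption with `n` samples per state. The rows of transition counts are
independent multinomial vectors with `E[X i] = n * P i`; the `n` rewards observed at a state `i`
are independent with common law `ν i`; the transition counts are independent of `b̂`. Rewards at
different states may be correlated. -/
structure SamplingModel (μ : Measure Ω) (n : ℕ) (P : Matrix S S ℝ) (ν : S → Measure ℝ)
    (X : Ω → S → S → ℕ) (R : S → Fin n → Ω → ℝ) : Prop where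
  hasLaw_row : ∀ i, HasLaw (fun ω => X ω i) (multinomialLaw n (P i)) μ
  indep_rows : iIndepFun (fun (i : S) (ω : Ω) => X ω i) μ
  hasLaw_reward : ∀ i k, HasLaw (R i k) (ν i) μ
  indep_reward : ∀ i, iIndepFun (R i) μ
  indep_transition_reward : IndepFun X (estB n R) μ

/-- The covariance matrix of a random vector. -/
def covMat (μ : Measure Ω) (c : Ω → S → ℝ) : Matrix S S ℝ :=
  Matrix.of fun i j => covariance (fun ω => c ω i) (fun ω => c ω j) μ

/-- The entrywise expectation of a random matrix. -/
def expMat (μ : Measure Ω) (F : Ω → Matrix S S ℝ) : Matrix S S ℝ :=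
  Matrix.of fun i j => ∫ ω, F ω i j ∂μ

/-! ### Mean square error and optimal factor -/

/-- The loss `‖v - ε v̂‖²_M`. -/
def loss (γ : ℝ) (P M : Matrix S S ℝ) (b : S → ℝ) (Phat : Matrix S S ℝ) (bhat : S → ℝ)
    (ε : ℝ) : ℝ :=
  sqNorm γ P M (valueFn γ P b - ε • valueFn γ Phat bhat)

/-- `MSE(ε) = E ‖v - ε v̂‖²_M`. -/
def MSE (μ : Measure Ω) (γ : ℝ) (P M : Matrix S S ℝ) (b : S → ℝ)
    (Phat : Ω → Matrix S S ℝ) (bhat : Ω → S → ℝ) (ε : ℝ) : ℝ :=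
  ∫ ω, loss γ P M b (Phat ω) (bhat ω) ε ∂μ

/-- The optimal augmentation factor `ε* = E[bᵀ M A v̂] / E[v̂ᵀ Aᵀ M A v̂]`. -/
def optFactor (μ : Measure Ω) (γ : ℝ) (P M : Matrix S S ℝ) (b : S → ℝ)
    (Phat : Ω → Matrix S S ℝ) (bhat : Ω → S → ℝ) : ℝ :=
  (∫ ω, b ⬝ᵥ ((M * sysMat γ P) *ᵥ valueFn γ (Phat ω) (bhat ω)) ∂μ) /
    ∫ ω, sqNorm γ P M (valueFn γ (Phat ω) (bhat ω)) ∂μ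

/-! ### The second-order approximation -/

/-- `B i = (diag (p i) - p i (p i)ᵀ) / n`, where `p i` is the `i`-th row of `P`. -/
def rowCov (n : ℕ) (P : Matrix S S ℝ) (i : S) : Matrix S S ℝ :=
  (1 / n : ℝ) • (Matrix.diagonal (P i) - Matrix.vecMulVec (P i) (P i))

/-- `G = γ² A⁻ᵀ (∑ i, M i i • B i) A⁻¹`. -/
def matG (n : ℕ) (γ : ℝ) (P M : Matrix S S ℝ) : Matrix S S ℝ :=
  γ ^ 2 • (((sysMat γ P)⁻¹)ᵀ * (∑ i, M i i • rowCov n P i) * (sysMat γ P)⁻¹)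

/-- `H = γ² (∑ i, A⁻ᵀ (B i) A⁻¹ diag(e i)) M + γ² M (∑ i, diag(e i) A⁻ᵀ (B i) A⁻¹)`. -/
def matH (n : ℕ) (γ : ℝ) (P M : Matrix S S ℝ) : Matrix S S ℝ :=
  γ ^ 2 • ((∑ i, ((sysMat γ P)⁻¹)ᵀ * rowCov n P i * (sysMat γ P)⁻¹ *
      Matrix.diagonal (Pi.single i (1 : ℝ))) * M) +
    γ ^ 2 • (M * ∑ i, Matrix.diagonal (Pi.single i (1 : ℝ)) * ((sysMat γ P)⁻¹)ᵀ *
      rowCov n P i * (sysMat γ P)⁻¹)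

/-- `Ŷ = (A - Â) A⁻¹`. -/
def matY (γ : ℝ) (P Phat : Matrix S S ℝ) : Matrix S S ℝ :=
  (sysMat γ P - sysMat γ Phat) * (sysMat γ P)⁻¹

/-- The quadratic form `bᵀ Q b`; for `Q = M`, `G`, `H` these are `‖b‖²_M`, `g`, `h`. -/
def quad (Q : Matrix S S ℝ) (b : S → ℝ) : ℝ := b ⬝ᵥ (Q *ᵥ b)

/-- `t = tr (cov[b̂] (M + G + H))`; the argument `Sig` is `cov[b̂]`. -/
def termT (n : ℕ) (γ : ℝ) (P M Sig : Matrix S S ℝ) : ℝ :=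
  (Sig * (M + matG n γ P M + matH n γ P M)).trace

/-- The denominator `bᵀ (M + G + H) b + tr (cov[b̂] (M + G + H))` of `ε°`. -/
def approxDenom (n : ℕ) (γ : ℝ) (P M : Matrix S S ℝ) (b : S → ℝ) (Sig : Matrix S S ℝ) : ℝ :=
  quad (M + matG n γ P M + matH n γ P M) b + termT n γ P M Sig

/-- The second-order approximation
`ε° = bᵀ (M + H/2) b / (bᵀ (M + G + H) b + tr (cov[b̂] (M + G + H)))`. -/
def approxFactor (n : ℕ) (γ : ℝ) (P M : Matrix S S ℝ) (b : S → ℝ) (Sig : Matrix S S ℝ) : ℝ :=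
  quad (M + (1 / 2 : ℝ) • matH n γ P M) b / approxDenom n γ P M b Sig

end

end OperatorAugmentation

namespace OperatorAugmentation

/-! ### Moments of the multinomial distribution -/

/-- The centred indicator whose sums over the trials are the centred cell counts. -/
def centredIndicator {S : Type*} [DecidableEq S] (p : S → ℝ) (j s : S) : ℝ := (if s = j then 1 else 0) - p j

theorem card_filter_sub_eq_sum_centredIndicator {S : Type*} [DecidableEq S] {p : S → ℝ} {n : ℕ}
    (f : Fin n → S) (j : S) :
    ((Finset.univ.filter fun k => f k = j).card : ℝ) - n * p j =
      ∑ k, centredIndicator p j (f k) := by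
  simp [centredIndicator, Finset.sum_sub_distrib]

section Multinomial

variable {S : Type*} [Fintype S]

theorem sum_fin_succ_pi {n : ℕ} (p : S → ℝ) (ψ : (Fin (n + 1) → S) → ℝ) :
    ∑ f : Fin (n + 1) → S, (∏ k, p (f k)) * ψ f =
      ∑ f : Fin n → S, (∏ k, p (f k)) * ∑ s, p s * ψ (Fin.cons s f) := by
  rw [← (Fin.consEquiv (fun _ : Fin (n + 1) => S)).sum_comp, Fintype.sum_prod_type,
    Finset.sum_comm]
  refine Finset.sum_congr rfl fun f _ => ?_
  rw [Finset.mul_sum]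
  refine Finset.sum_congr rfl fun s _ => ?_
  simp [Fin.consEquiv, Fin.prod_univ_succ]
  ring

variable {p : S → ℝ}

theorem sum_weights (h1 : ∑ s, p s = 1) (n : ℕ) :
    ∑ f : Fin n → S, ∏ k, p (f k) = 1 := by
  induction n with
  | zero => simp
  | succ n ih =>
    have := sum_fin_succ_pi (n := n) p (fun _ => 1)
    simpa [h1, ih] using this

theorem sum_weights_mul_dev (h1 : ∑ s, p s = 1) {ξ : S → ℝ} (hξ : ∑ s, p s * ξ s = 0) (n : ℕ) :
    ∑ f : Fin n → S, (∏ k, p (f k)) * ∑ k, ξ (f k) = 0 := by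
  induction n with
  | zero => simp
  | succ n ih =>
    rw [sum_fin_succ_pi, ← ih]
    refine Finset.sum_congr rfl fun f _ => ?_
    congr 1
    simp [Fin.sum_univ_succ, mul_add, Finset.sum_add_distrib, hξ, ← Finset.sum_mul, h1]

theorem sum_weights_mul_dev_mul_dev (h1 : ∑ s, p s = 1) {ξ η : S → ℝ}
    (hξ : ∑ s, p s * ξ s = 0) (hη : ∑ s, p s * η s = 0) (n : ℕ) :
    ∑ f : Fin n → S, (∏ k, p (f k)) * ((∑ k, ξ (f k)) * ∑ k, η (f k)) =
      n * ∑ s, p s * (ξ s * η s) := by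
  induction n with
  | zero => simp
  | succ n ih =>
    rw [sum_fin_succ_pi]
    have key : ∀ f : Fin n → S,
        ∑ s, p s * ((∑ k, ξ ((Fin.cons s f : Fin (n + 1) → S) k)) *
          ∑ k, η ((Fin.cons s f : Fin (n + 1) → S) k)) =
        (∑ s, p s * (ξ s * η s)) + (∑ k, ξ (f k)) * ∑ k, η (f k) := by
      intro f
      simp only [Fin.sum_univ_succ, Fin.cons_zero, Fin.cons_succ]
      set a := ∑ k, ξ (f k)
      set c := ∑ k, η (f k)
      calc ∑ s, p s * ((ξ s + a) * (η s + c))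
          = ∑ s, (p s * (ξ s * η s) + (p s * ξ s) * c + (p s * η s) * a + p s * (a * c)) :=
            Finset.sum_congr rfl fun s _ => by ring
        _ = _ := by
            simp only [Finset.sum_add_distrib, ← Finset.sum_mul, hξ, hη, h1]; ring
    simp only [key, mul_add, Finset.sum_add_distrib, ← Finset.sum_mul, sum_weights h1, ih]
    push_cast; ring

theorem sum_weights_mul_dev_pow_four_le (h0 : ∀ s, 0 ≤ p s) (h1 : ∑ s, p s = 1) {ξ : S → ℝ}
    (hξ : ∑ s, p s * ξ s = 0) (hb : ∀ s, |ξ s| ≤ 1) (n : ℕ) :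
    ∑ f : Fin n → S, (∏ k, p (f k)) * (∑ k, ξ (f k)) ^ 4 ≤ 3 * (n : ℝ) ^ 2 := by
  have hsq : ∀ s, ξ s ^ 2 ≤ 1 := fun s => (sq_le_one_iff_abs_le_one _).2 (hb s)
  have hm2 : ∑ s, p s * (ξ s * ξ s) ≤ 1 := by
    rw [← h1]
    exact Finset.sum_le_sum fun s _ => by nlinarith [hsq s, h0 s]
  have hm2' : 0 ≤ ∑ s, p s * (ξ s * ξ s) :=
    Finset.sum_nonneg fun s _ => mul_nonneg (h0 s) (mul_self_nonneg _)
  have hm4 : ∑ s, p s * ξ s ^ 4 ≤ 1 := by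
    rw [← h1]
    exact Finset.sum_le_sum fun s _ => by nlinarith [hsq s, h0 s, mul_nonneg (h0 s) (sq_nonneg (ξ s))]
  induction n with
  | zero => simp
  | succ n ih =>
    rw [sum_fin_succ_pi]
    have key : ∀ f : Fin n → S,
        ∑ s, p s * (∑ k, ξ ((Fin.cons s f : Fin (n + 1) → S) k)) ^ 4 =
        (∑ s, p s * ξ s ^ 4) + 4 * (∑ s, p s * ξ s ^ 3) * (∑ k, ξ (f k)) +
          6 * (∑ s, p s * (ξ s * ξ s)) * ((∑ k, ξ (f k)) * ∑ k, ξ (f k)) +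
          (∑ k, ξ (f k)) ^ 4 := by
      intro f
      simp only [Fin.sum_univ_succ, Fin.cons_zero, Fin.cons_succ]
      set a := ∑ k, ξ (f k)
      calc ∑ s, p s * (ξ s + a) ^ 4
          = ∑ s, (p s * ξ s ^ 4 + (p s * ξ s ^ 3) * (4 * a) +
              (p s * (ξ s * ξ s)) * (6 * (a * a)) + (p s * ξ s) * (4 * a ^ 3) + p s * a ^ 4) :=
            Finset.sum_congr rfl fun s _ => by ring
        _ = _ := by
            simp only [Finset.sum_add_distrib, ← Finset.sum_mul, hξ, h1]; ring
    have expand : ∑ f : Fin n → S, (∏ k, p (f k)) *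
          ∑ s, p s * (∑ k, ξ ((Fin.cons s f : Fin (n + 1) → S) k)) ^ 4 =
        (∑ s, p s * ξ s ^ 4) +
          6 * (∑ s, p s * (ξ s * ξ s)) * (n * ∑ s, p s * (ξ s * ξ s)) +
          ∑ f : Fin n → S, (∏ k, p (f k)) * (∑ k, ξ (f k)) ^ 4 := by
      rw [← sum_weights_mul_dev_mul_dev h1 hξ hξ n]
      have e1 := sum_weights h1 n
      have e2 := sum_weights_mul_dev h1 hξ n
      calc _ = ∑ f : Fin n → S, ((∏ k, p (f k)) * (∑ s, p s * ξ s ^ 4) +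
            (4 * (∑ s, p s * ξ s ^ 3)) * ((∏ k, p (f k)) * (∑ k, ξ (f k))) +
            (6 * (∑ s, p s * (ξ s * ξ s))) *
              ((∏ k, p (f k)) * ((∑ k, ξ (f k)) * ∑ k, ξ (f k))) +
            (∏ k, p (f k)) * (∑ k, ξ (f k)) ^ 4) :=
            Finset.sum_congr rfl fun f _ => by rw [key]; ring
        _ = _ := by
            simp only [Finset.sum_add_distrib, ← Finset.mul_sum, ← Finset.sum_mul, e1, e2]
            ring
    rw [expand]
    push_cast
    have : (∑ s, p s * (ξ s * ξ s)) * (∑ s, p s * (ξ s * ξ s)) ≤ 1 := by nlinarith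
    nlinarith [Nat.cast_nonneg (α := ℝ) n]

variable [DecidableEq S]

theorem integral_multinomialLaw (h0 : ∀ s, 0 ≤ p s) (n : ℕ) (φ : (S → ℕ) → ℝ) :
    ∫ x, φ x ∂(multinomialLaw n p) = ∑ f : Fin n → S, (∏ k, p (f k)) *
      φ (fun j => (Finset.univ.filter fun k => f k = j).card) := by
  rw [multinomialLaw, integral_finsetSum_measure]
  · refine Finset.sum_congr rfl fun f _ => ?_
    rw [integral_smul_measure, integral_dirac, ENNReal.toReal_ofReal
      (Finset.prod_nonneg fun k _ => h0 _), smul_eq_mul]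
  · intro f _
    exact (integrable_dirac (by simp)).smul_measure ENNReal.ofReal_ne_top

theorem multinomialLaw_ae_sum_eq (n : ℕ) (p : S → ℝ) :
    ∀ᵐ x ∂(multinomialLaw n p), ∑ j, x j = n := by
  rw [ae_iff, multinomialLaw, Measure.finsetSum_apply]
  refine Finset.sum_eq_zero fun f _ => ?_
  have hf : ∑ j, (Finset.univ.filter fun k => f k = j).card = n := by
    rw [← Finset.card_eq_sum_card_fiberwise (fun _ _ => Finset.mem_coe.2 (Finset.mem_univ _))]
    simp
  simp [hf]

theorem sum_mul_centredIndicator (h1 : ∑ s, p s = 1) (j : S) :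
    ∑ s, p s * centredIndicator p j s = 0 := by
  simp [centredIndicator, mul_sub, Finset.sum_sub_distrib, ← Finset.sum_mul, h1]

theorem abs_centredIndicator_le (h0 : ∀ s, 0 ≤ p s) (h1 : ∑ s, p s = 1) (j s : S) :
    |centredIndicator p j s| ≤ 1 := by
  have h2 : p j ≤ 1 := h1 ▸ Finset.single_le_sum (fun s _ => h0 s) (Finset.mem_univ j)
  have h3 := h0 j
  rw [abs_le, centredIndicator]
  split_ifs <;> constructor <;> linarith

theorem sum_mul_centredIndicator_mul (h1 : ∑ s, p s = 1) (j l : S) :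
    ∑ s, p s * (centredIndicator p j s * centredIndicator p l s) =
      (diagonal p - vecMulVec p p) j l := by
  have : ∀ s, p s * (centredIndicator p j s * centredIndicator p l s) =
      (if s = j then (if s = l then p s else 0) else 0) - (if s = j then p s * p l else 0)
        - (if s = l then p s * p j else 0) + p s * (p j * p l) := by
    intro s
    unfold centredIndicator
    split_ifs <;> ring
  simp only [this, Finset.sum_add_distrib, Finset.sum_sub_distrib, ← Finset.sum_mul, h1]
  simp [vecMulVec_apply, diagonal_apply]
  ring

theorem integral_multinomialLaw_centred (h0 : ∀ s, 0 ≤ p s) (h1 : ∑ s, p s = 1) (n : ℕ) (j : S) :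
    ∫ x, ((x j : ℝ) - n * p j) ∂(multinomialLaw n p) = 0 := by
  rw [integral_multinomialLaw h0 n (fun x => (x j : ℝ) - n * p j)]
  simp only [card_filter_sub_eq_sum_centredIndicator]
  exact sum_weights_mul_dev h1 (sum_mul_centredIndicator h1 j) n

theorem integral_multinomialLaw_centred_mul (h0 : ∀ s, 0 ≤ p s) (h1 : ∑ s, p s = 1) (n : ℕ)
    (j l : S) :
    ∫ x, ((x j : ℝ) - n * p j) * ((x l : ℝ) - n * p l) ∂(multinomialLaw n p) =
      n * (diagonal p - vecMulVec p p) j l := by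
  rw [integral_multinomialLaw h0 n (fun x => ((x j : ℝ) - n * p j) * ((x l : ℝ) - n * p l))]
  simp only [card_filter_sub_eq_sum_centredIndicator]
  rw [sum_weights_mul_dev_mul_dev h1 (sum_mul_centredIndicator h1 j)
    (sum_mul_centredIndicator h1 l), sum_mul_centredIndicator_mul h1]

theorem integral_multinomialLaw_centred_pow_four_le (h0 : ∀ s, 0 ≤ p s) (h1 : ∑ s, p s = 1)
    (n : ℕ) (j : S) :
    ∫ x, ((x j : ℝ) - n * p j) ^ 4 ∂(multinomialLaw n p) ≤ 3 * (n : ℝ) ^ 2 := by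
  rw [integral_multinomialLaw h0 n (fun x => ((x j : ℝ) - n * p j) ^ 4)]
  simp only [card_filter_sub_eq_sum_centredIndicator]
  exact sum_weights_mul_dev_pow_four_le h0 h1 (sum_mul_centredIndicator h1 j)
    (abs_centredIndicator_le h0 h1 j) n

end Multinomial

/-! ### Moments of the estimates -/

/-- The matrix of relative frequencies of a matrix of counts. -/
noncomputable def freqMat {S : Type*} (n : ℕ) (x : S → S → ℕ) : Matrix S S ℝ :=
  Matrix.of fun i j => (x i j : ℝ) / n

/-- The sum of the absolute values of the entries of `freqMat n x - P`. -/
noncomputable def absDev {S : Type*} [Fintype S] (n : ℕ) (P : Matrix S S ℝ) (x : S → S → ℕ) : ℝ :=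
  ∑ q : S × S, |(freqMat n x - P) q.1 q.2|

theorem abs_pow_three_le_of_pos {s : ℝ} (hs : 0 < s) (x : ℝ) :
    |x| ^ 3 ≤ (s * (x * x) + x ^ 4 / s) / 2 := by
  have h : (s * (x * x) + x ^ 4 / s) / 2 - |x| ^ 3 = |x| ^ 2 * (s - |x|) ^ 2 / (2 * s) := by
    rw [← abs_mul_abs_self x, show x ^ 4 = |x| ^ 4 from (Even.pow_abs ⟨2, rfl⟩ x).symm]
    field_simp
    ring
  have : 0 ≤ |x| ^ 2 * (s - |x|) ^ 2 / (2 * s) := by positivity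
  linarith

namespace SamplingModel

section

variable {S : Type*} [Fintype S] [DecidableEq S] {Ω : Type*} [MeasurableSpace Ω]
  {μ : Measure Ω} {n : ℕ} {P : Matrix S S ℝ} {ν : S → Measure ℝ}
  {X : Ω → S → S → ℕ} {R : S → Fin n → Ω → ℝ}

theorem aemeasurable_counts (hS : SamplingModel μ n P ν X R) : AEMeasurable X μ :=
  aemeasurable_pi_iff.2 fun i => (hS.hasLaw_row i).aemeasurable

theorem ae_sum_counts (hS : SamplingModel μ n P ν X R) : ∀ᵐ ω ∂μ, ∀ i, ∑ j, X ω i j = n :=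
  ae_all_iff.2 fun i => ((hS.hasLaw_row i).ae_iff (p := fun x => ∑ j, x j = n)
    (measurableSet_setOfPred.1 .of_discrete)).2 (multinomialLaw_ae_sum_eq n (P i))

theorem ae_freqMat_mem_rowStochastic (hS : SamplingModel μ n P ν X R) (hn : n ≠ 0) :
    ∀ᵐ ω ∂μ, freqMat n (X ω) ∈ Matrix.rowStochastic ℝ S := by
  filter_upwards [hS.ae_sum_counts] with ω hω
  refine ⟨fun i j => by simp only [freqMat, of_apply]; positivity, ?_⟩
  ext i
  have hn' : (n : ℝ) ≠ 0 := Nat.cast_ne_zero.2 hn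
  simp only [mulVec, dotProduct, freqMat, of_apply, Pi.one_apply, mul_one, ← Finset.sum_div]
  rw [← Nat.cast_sum, hω i, div_self hn']

theorem integrable_counts [IsFiniteMeasure μ] (hS : SamplingModel μ n P ν X R)
    (F : (S → S → ℕ) → ℝ) : Integrable (fun ω => F (X ω)) μ := by
  have hfin : (Set.Icc (0 : S → S → ℕ) (fun _ _ => n)).Finite := Set.finite_Icc _ _
  obtain ⟨c, hc⟩ := (hfin.image fun x => ‖F x‖).bddAbove
  refine Integrable.of_bound
    (((measurable_of_countable F).comp_aemeasurable hS.aemeasurable_counts).aestronglyMeasurable)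
    c ?_
  filter_upwards [hS.ae_sum_counts] with ω hω
  refine hc ⟨X ω, ⟨fun i j => Nat.zero_le _, fun i j => ?_⟩, rfl⟩
  rw [← hω i]
  exact Finset.single_le_sum (fun _ _ => Nat.zero_le _) (Finset.mem_univ j)

theorem integral_row (hS : SamplingModel μ n P ν X R) (i : S) (φ : (S → ℕ) → ℝ) :
    ∫ ω, φ (X ω i) ∂μ = ∫ x, φ x ∂(multinomialLaw n (P i)) :=
  (hS.hasLaw_row i).integral_comp (f := φ) (measurable_of_countable φ).aestronglyMeasurable

variable (hP : P ∈ Matrix.rowStochastic ℝ S)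
include hP

theorem integral_dev (hS : SamplingModel μ n P ν X R) (hn : n ≠ 0) (i j : S) :
    ∫ ω, (freqMat n (X ω) - P) i j ∂μ = 0 := by
  have hn' : (n : ℝ) ≠ 0 := Nat.cast_ne_zero.2 hn
  have h := integral_multinomialLaw_centred (hP.1 i) (Matrix.sum_row_of_mem_rowStochastic hP i) n j
  rw [← hS.integral_row i (fun x => (x j : ℝ) - n * P i j)] at h
  rw [← zero_div (n : ℝ), ← h, ← integral_div]
  refine integral_congr_ae (.of_forall fun ω => ?_)
  simp only [freqMat, Matrix.sub_apply, of_apply]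
  field_simp

theorem integral_dev_mul_dev_row (hS : SamplingModel μ n P ν X R) (hn : n ≠ 0) (i j l : S) :
    ∫ ω, (freqMat n (X ω) - P) i j * (freqMat n (X ω) - P) i l ∂μ = rowCov n P i j l := by
  have hn' : (n : ℝ) ≠ 0 := Nat.cast_ne_zero.2 hn
  have h := integral_multinomialLaw_centred_mul (hP.1 i)
    (Matrix.sum_row_of_mem_rowStochastic hP i) n j l
  rw [← hS.integral_row i (fun x => ((x j : ℝ) - n * P i j) * ((x l : ℝ) - n * P i l))] at h
  have h2 : rowCov n P i j l = (n * (diagonal (P i) - vecMulVec (P i) (P i)) j l) / (n : ℝ) ^ 2 := by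
    simp only [rowCov, Matrix.smul_apply, smul_eq_mul]
    field_simp
  rw [h2, ← h, ← integral_div]
  refine integral_congr_ae (.of_forall fun ω => ?_)
  simp only [freqMat, Matrix.sub_apply, of_apply]
  field_simp

theorem integral_dev_pow_four_le (hS : SamplingModel μ n P ν X R) (hn : n ≠ 0) (i j : S) :
    ∫ ω, (freqMat n (X ω) - P) i j ^ 4 ∂μ ≤ 3 / (n : ℝ) ^ 2 := by
  have hn' : (n : ℝ) ≠ 0 := Nat.cast_ne_zero.2 hn
  have h := integral_multinomialLaw_centred_pow_four_le (hP.1 i)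
    (Matrix.sum_row_of_mem_rowStochastic hP i) n j
  rw [← hS.integral_row i (fun x => ((x j : ℝ) - n * P i j) ^ 4)] at h
  have h2 : ∫ ω, (freqMat n (X ω) - P) i j ^ 4 ∂μ =
      (∫ ω, ((X ω i j : ℝ) - n * P i j) ^ 4 ∂μ) / (n : ℝ) ^ 4 := by
    rw [← integral_div]
    refine integral_congr_ae (.of_forall fun ω => ?_)
    simp only [freqMat, Matrix.sub_apply, of_apply]
    field_simp
  rw [h2, div_le_div_iff₀ (by positivity) (by positivity)]
  nlinarith [mul_le_mul_of_nonneg_right h (sq_nonneg (n : ℝ))]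

theorem integral_dev_mul_dev (hS : SamplingModel μ n P ν X R) (hn : n ≠ 0) (i j k l : S) :
    ∫ ω, (freqMat n (X ω) - P) i j * (freqMat n (X ω) - P) k l ∂μ =
      if i = k then rowCov n P i j l else 0 := by
  split_ifs with hik
  · subst hik
    exact hS.integral_dev_mul_dev_row hP hn i j l
  · have hind := (hS.indep_rows.indepFun hik).integral_fun_comp_mul_comp
      (f := fun x : S → ℕ => (x j : ℝ) / n - P i j) (g := fun x : S → ℕ => (x l : ℝ) / n - P k l)
      (hS.hasLaw_row i).aemeasurable (hS.hasLaw_row k).aemeasurable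
      (measurable_of_countable _).aestronglyMeasurable
      (measurable_of_countable _).aestronglyMeasurable
    have h0 := hS.integral_dev hP hn i j
    simp only [freqMat, Matrix.sub_apply, of_apply] at h0 ⊢
    rw [hind, h0, zero_mul]

theorem integral_abs_dev_pow_three_le [IsFiniteMeasure μ] (hS : SamplingModel μ n P ν X R)
    (hn : n ≠ 0) (i j : S) :
    ∫ ω, |(freqMat n (X ω) - P) i j| ^ 3 ∂μ ≤ 2 * (n : ℝ) ^ (-(3 / 2 : ℝ)) := by
  have hn' : (0 : ℝ) < n := Nat.cast_pos.2 (Nat.pos_of_ne_zero hn)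
  set s : ℝ := (n : ℝ) ^ (-(1 / 2 : ℝ)) with hs
  have hs0 : 0 < s := Real.rpow_pos_of_pos hn' _
  have hs2 : s ^ 2 = 1 / n := by
    rw [hs, ← Real.rpow_natCast, ← Real.rpow_mul hn'.le]
    norm_num [Real.rpow_neg_one]
  have hs3 : (n : ℝ) ^ (-(3 / 2 : ℝ)) = s ^ 3 := by
    rw [hs, ← Real.rpow_natCast, ← Real.rpow_mul hn'.le]
    norm_num
  have hint := fun F => hS.integrable_counts F
  have h1 : ∫ ω, |(freqMat n (X ω) - P) i j| ^ 3 ∂μ ≤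
      ∫ ω, (s * ((freqMat n (X ω) - P) i j * (freqMat n (X ω) - P) i j) +
        (freqMat n (X ω) - P) i j ^ 4 / s) / 2 ∂μ :=
    integral_mono (hint fun x => |(freqMat n x - P) i j| ^ 3)
      (hint fun x => (s * ((freqMat n x - P) i j * (freqMat n x - P) i j) +
        (freqMat n x - P) i j ^ 4 / s) / 2) fun ω => abs_pow_three_le_of_pos hs0 _
  refine h1.trans ?_
  rw [integral_div, integral_add (hint fun x => s * ((freqMat n x - P) i j * (freqMat n x - P) i j))
    (hint fun x => (freqMat n x - P) i j ^ 4 / s), integral_const_mul, integral_div,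
    hS.integral_dev_mul_dev_row hP hn]
  have h4 := hS.integral_dev_pow_four_le hP hn i j
  have h2 : rowCov n P i j j ≤ s ^ 2 := by
    rw [hs2]
    have hp0 := hP.1 i j
    have hp1 : P i j ≤ 1 := Matrix.sum_row_of_mem_rowStochastic hP i ▸
      Finset.single_le_sum (fun s _ => hP.1 i s) (Finset.mem_univ j)
    simp only [rowCov, Matrix.smul_apply, smul_eq_mul, Matrix.sub_apply, diagonal_apply_eq, vecMulVec_apply]
    exact mul_le_of_le_one_right (by positivity) (by nlinarith)
  have h4' : 3 / (n : ℝ) ^ 2 = 3 * s ^ 4 := by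
    rw [show s ^ 4 = (s ^ 2) ^ 2 by ring, hs2]; field_simp
  rw [h4'] at h4
  have h5 := div_le_div_of_nonneg_right h4 hs0.le
  have h6 : 3 * s ^ 4 / s = 3 * s ^ 3 := by field_simp
  rw [h6] at h5
  rw [hs3]
  nlinarith [mul_le_mul_of_nonneg_left h2 hs0.le]

theorem integral_absDev_pow_three_le [IsFiniteMeasure μ] (hS : SamplingModel μ n P ν X R)
    (hn : n ≠ 0) :
    ∫ ω, absDev n P (X ω) ^ 3 ∂μ ≤
      2 * (Fintype.card (S × S) : ℝ) ^ 3 * (n : ℝ) ^ (-(3 / 2 : ℝ)) := by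
  set N : ℝ := ((Fintype.card (S × S) : ℕ) : ℝ) with hN
  have hpt : ∀ x : S → S → ℕ,
      absDev n P x ^ 3 ≤ N ^ 2 * ∑ q : S × S, |(freqMat n x - P) q.1 q.2| ^ 3 := by
    intro x
    have h := pow_sum_div_card_le_sum_pow (s := (Finset.univ : Finset (S × S)))
      (f := fun q => |(freqMat n x - P) q.1 q.2|) (fun _ _ => abs_nonneg _) 2
    rcases isEmpty_or_nonempty (S × S) with he | hne
    · simp [absDev]
    · have hN0 : 0 < N := Nat.cast_pos.2 Fintype.card_pos
      rwa [Finset.card_univ, div_le_iff₀ (by positivity), mul_comm] at h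
  calc ∫ ω, absDev n P (X ω) ^ 3 ∂μ
      ≤ ∫ ω, N ^ 2 * ∑ q : S × S, |(freqMat n (X ω) - P) q.1 q.2| ^ 3 ∂μ :=
        integral_mono (hS.integrable_counts fun x => absDev n P x ^ 3)
          (hS.integrable_counts fun x => N ^ 2 * ∑ q : S × S, |(freqMat n x - P) q.1 q.2| ^ 3)
          fun ω => hpt (X ω)
    _ = N ^ 2 * ∑ q : S × S, ∫ ω, |(freqMat n (X ω) - P) q.1 q.2| ^ 3 ∂μ := by
        rw [integral_const_mul, integral_finsetSum]
        exact fun q _ => hS.integrable_counts fun x => |(freqMat n x - P) q.1 q.2| ^ 3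
    _ ≤ N ^ 2 * ∑ _q : S × S, 2 * (n : ℝ) ^ (-(3 / 2 : ℝ)) := by
        gcongr with q
        exact hS.integral_abs_dev_pow_three_le hP hn q.1 q.2
    _ = 2 * N ^ 3 * (n : ℝ) ^ (-(3 / 2 : ℝ)) := by
        rw [Finset.sum_const, Finset.card_univ, nsmul_eq_mul]
        ring

end

end SamplingModel

/-! ### Expansion of the resolvent -/

section Resolvent

theorem resolvent_expansion {A : Type*} [Ring A] {y k : A} (hk : k = 1 + y * k) :
    k - (1 + y + y ^ 2) = y ^ 3 * k := by
  have h1 : y * k = k - 1 := by rw [eq_sub_iff_add_eq, add_comm]; exact hk.symm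
  have h3 : y ^ 3 * k = y * (y * (y * k)) := by noncomm_ring
  rw [h3, h1, mul_sub, h1, mul_one, mul_sub, mul_sub, h1]
  noncomm_ring

theorem resolvent_quadratic_expansion {A : Type*} [Ring A] {y k y' k' m : A}
    (hk : k = 1 + y * k) (hk' : k' = 1 + k' * y') :
    k' * m * k - (m + m * y + y' * m + y' * m * y + (y' ^ 2 * m + m * y ^ 2)) =
      k' * y' ^ 3 * m * k + m * (y ^ 3 * k) + y' * m * (y ^ 2 * k) + y' ^ 2 * m * (y * k) := by
  have h1 : y * k = k - 1 := by rw [eq_sub_iff_add_eq, add_comm]; exact hk.symm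
  have h2 : y ^ 2 * k = k - 1 - y := by
    rw [pow_two, mul_assoc, h1, mul_sub, h1, mul_one]
  have h3 : y ^ 3 * k = k - 1 - y - y ^ 2 := by
    rw [← resolvent_expansion hk]; abel
  have h1' : k' * y' = k' - 1 := by rw [eq_sub_iff_add_eq, add_comm]; exact hk'.symm
  have h3' : k' * y' ^ 3 = k' - 1 - y' - y' ^ 2 := by
    have : k' * y' ^ 3 = k' * y' * y' * y' := by noncomm_ring
    rw [this, h1', sub_mul, h1', one_mul, sub_mul, sub_mul, h1']
    noncomm_ring
  rw [h1, h2, h3, h3']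
  noncomm_ring

variable {S : Type*} [Fintype S] [DecidableEq S]

section Frobenius

open scoped Matrix.Norms.Frobenius

theorem frobenius_norm_sq (A : Matrix S S ℝ) : ‖A‖ ^ 2 = ∑ q : S × S, A q.1 q.2 ^ 2 := by
  rw [Matrix.frobenius_norm_def, ← Real.sqrt_eq_rpow, Real.sq_sqrt (by positivity),
    Fintype.sum_prod_type]
  simp

theorem abs_entry_le_frobenius_norm (A : Matrix S S ℝ) (i j : S) : |A i j| ≤ ‖A‖ := by
  refine abs_le_of_sq_le_sq ?_ (norm_nonneg _)
  rw [frobenius_norm_sq]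
  exact Finset.single_le_sum (f := fun q : S × S => A q.1 q.2 ^ 2)
    (fun _ _ => sq_nonneg _) (Finset.mem_univ (i, j))

theorem frobenius_norm_le_sum_abs (A : Matrix S S ℝ) : ‖A‖ ≤ ∑ q : S × S, |A q.1 q.2| := by
  refine le_of_sq_le_sq ?_ (Finset.sum_nonneg fun _ _ => abs_nonneg _)
  rw [frobenius_norm_sq]
  simp_rw [← sq_abs (A _ _)]
  exact Finset.sum_sq_le_sq_sum_of_nonneg fun _ _ => abs_nonneg _

end Frobenius

theorem abs_inv_sysMat_le {γ : ℝ} (hγ0 : 0 < γ) (hγ1 : γ < 1) {Q : Matrix S S ℝ}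
    (hQ : Q ∈ Matrix.rowStochastic ℝ S) (i j : S) :
    |(sysMat γ Q)⁻¹ i j| ≤ 1 / (1 - γ) := by
  have hinv := Matrix.mul_nonsing_inv _ (isUnit_det_sysMat hγ0 hγ1 hQ)
  set B := (sysMat γ Q)⁻¹
  have : Nonempty S := ⟨i⟩
  obtain ⟨m, hm⟩ := Finite.exists_max fun k => |B k j|
  have hB : B m j = (1 : Matrix S S ℝ) m j + γ * ∑ k, Q m k * B k j := by
    rw [← hinv, sysMat, Matrix.sub_mul, Matrix.sub_apply, Matrix.one_mul, Matrix.smul_mul,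
      Matrix.smul_apply, Matrix.mul_apply, smul_eq_mul]
    ring
  have h1 : |(1 : Matrix S S ℝ) m j| ≤ 1 := by
    rw [Matrix.one_apply]; split_ifs <;> simp
  have h2 : |∑ k, Q m k * B k j| ≤ |B m j| := by
    calc |∑ k, Q m k * B k j| ≤ ∑ k, |Q m k * B k j| := Finset.abs_sum_le_sum_abs _ _
      _ ≤ ∑ k, Q m k * |B m j| := by
          refine Finset.sum_le_sum fun k _ => ?_
          rw [abs_mul, abs_of_nonneg (hQ.1 m k)]
          exact mul_le_mul_of_nonneg_left (hm k) (hQ.1 m k)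
      _ = |B m j| := by
          rw [← Finset.sum_mul, Matrix.sum_row_of_mem_rowStochastic hQ, one_mul]
  have h3 : |B m j| ≤ 1 + γ * |B m j| := by
    calc |B m j| ≤ |(1 : Matrix S S ℝ) m j| + |γ * ∑ k, Q m k * B k j| := by
          conv_lhs => rw [hB]
          exact abs_add_le _ _
      _ ≤ 1 + γ * |B m j| := by
          rw [abs_mul, abs_of_pos hγ0]
          exact add_le_add h1 (mul_le_mul_of_nonneg_left h2 hγ0.le)
  refine (hm i).trans ?_
  rw [le_div_iff₀ (by linarith)]
  linarith

/-- `A Â⁻¹ = (I - Ŷ)⁻¹`. -/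
noncomputable def resolvent (γ : ℝ) (P Q : Matrix S S ℝ) : Matrix S S ℝ :=
  sysMat γ P * (sysMat γ Q)⁻¹

theorem matY_eq (γ : ℝ) (P Q : Matrix S S ℝ) :
    matY γ P Q = γ • ((Q - P) * (sysMat γ P)⁻¹) := by
  rw [matY, sysMat, sysMat, ← Matrix.smul_mul, sub_sub_sub_cancel_left, smul_sub]

theorem resolvent_eq {γ : ℝ} (hγ0 : 0 < γ) (hγ1 : γ < 1) {P Q : Matrix S S ℝ}
    (hP : P ∈ Matrix.rowStochastic ℝ S) (hQ : Q ∈ Matrix.rowStochastic ℝ S) :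
    resolvent γ P Q = 1 + matY γ P Q * resolvent γ P Q := by
  have h1 := Matrix.nonsing_inv_mul _ (isUnit_det_sysMat hγ0 hγ1 hP)
  have h2 := Matrix.mul_nonsing_inv _ (isUnit_det_sysMat hγ0 hγ1 hQ)
  rw [matY, resolvent, Matrix.mul_assoc, ← Matrix.mul_assoc (sysMat γ P)⁻¹, h1, Matrix.one_mul,
    Matrix.sub_mul, h2]
  abel

open scoped Matrix.Norms.Frobenius in
theorem exists_resolvent_bounds {γ : ℝ} (hγ0 : 0 < γ) (hγ1 : γ < 1) {P : Matrix S S ℝ}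
    (hP : P ∈ Matrix.rowStochastic ℝ S) (M : Matrix S S ℝ) :
    ∃ c : ℝ, 0 ≤ c ∧ ∀ Q ∈ Matrix.rowStochastic ℝ S, ∀ i j,
      |(M * resolvent γ P Q - (M + M * matY γ P Q + M * matY γ P Q ^ 2)) i j| ≤
          c * (∑ q : S × S, |(Q - P) q.1 q.2|) ^ 3 ∧
      |((resolvent γ P Q)ᵀ * M * resolvent γ P Q -
        (M + M * matY γ P Q + (matY γ P Q)ᵀ * M + (matY γ P Q)ᵀ * M * matY γ P Q +
          ((matY γ P Q)ᵀ ^ 2 * M + M * matY γ P Q ^ 2))) i j| ≤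
          c * (∑ q : S × S, |(Q - P) q.1 q.2|) ^ 3 := by
  set κ : ℝ := ‖sysMat γ P‖ * ∑ _q : S × S, 1 / (1 - γ) with hκ
  have hκ0 : 0 ≤ κ := by
    have : 0 < 1 - γ := by linarith
    positivity
  set a : ℝ := γ * ‖(sysMat γ P)⁻¹‖
  have ha : 0 ≤ a := by positivity
  refine ⟨a ^ 3 * ‖M‖ * (κ ^ 2 + 3 * κ), by positivity, fun Q hQ i j => ?_⟩
  set D := ∑ q : S × S, |(Q - P) q.1 q.2|
  have hD : 0 ≤ D := Finset.sum_nonneg fun _ _ => abs_nonneg _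
  have hk := resolvent_eq hγ0 hγ1 hP hQ
  have hK : ‖resolvent γ P Q‖ ≤ κ := by
    refine (norm_mul_le _ _).trans (mul_le_mul_of_nonneg_left ?_ (norm_nonneg _))
    exact (frobenius_norm_le_sum_abs _).trans
      (Finset.sum_le_sum fun q _ => abs_inv_sysMat_le hγ0 hγ1 hQ q.1 q.2)
  have hY : ‖matY γ P Q‖ ≤ a * D := by
    rw [matY_eq, norm_smul, Real.norm_of_nonneg hγ0.le]
    calc γ * ‖(Q - P) * (sysMat γ P)⁻¹‖ ≤ γ * (D * ‖(sysMat γ P)⁻¹‖) := by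
          gcongr
          exact (norm_mul_le _ _).trans (by gcongr; exact frobenius_norm_le_sum_abs _)
      _ = a * D := by ring
  have hkt : (resolvent γ P Q)ᵀ = 1 + (resolvent γ P Q)ᵀ * (matY γ P Q)ᵀ := by
    conv_lhs => rw [hk]
    rw [transpose_add, transpose_one, transpose_mul]
  have hYt : ‖(matY γ P Q)ᵀ‖ ≤ a * D := by rwa [Matrix.frobenius_norm_transpose]
  have hKt : ‖(resolvent γ P Q)ᵀ‖ ≤ κ := by rwa [Matrix.frobenius_norm_transpose]
  have hE := resolvent_expansion hk
  have hE2 := resolvent_quadratic_expansion (m := M) hk hkt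
  set Y := matY γ P Q
  set K := resolvent γ P Q
  have hY2 : ‖Y ^ 2‖ ≤ (a * D) ^ 2 :=
    (norm_pow_le' _ two_pos).trans (by gcongr)
  have hY3 : ‖Y ^ 3‖ ≤ (a * D) ^ 3 :=
    (norm_pow_le' _ three_pos).trans (by gcongr)
  have hYt2 : ‖Yᵀ ^ 2‖ ≤ (a * D) ^ 2 :=
    (norm_pow_le' _ two_pos).trans (by gcongr)
  have hYt3 : ‖Yᵀ ^ 3‖ ≤ (a * D) ^ 3 :=
    (norm_pow_le' _ three_pos).trans (by gcongr)
  have e1 : ‖M * (Y ^ 3 * K)‖ ≤ ‖M‖ * ((a * D) ^ 3 * κ) :=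
    norm_mul_le_of_le le_rfl (norm_mul_le_of_le hY3 hK)
  have e2 : ‖Kᵀ * Yᵀ ^ 3 * M * K‖ ≤ κ * (a * D) ^ 3 * ‖M‖ * κ :=
    norm_mul_le_of_le (norm_mul_le_of_le (norm_mul_le_of_le hKt hYt3) le_rfl) hK
  have e3 : ‖Yᵀ * M * (Y ^ 2 * K)‖ ≤ (a * D) * ‖M‖ * ((a * D) ^ 2 * κ) :=
    norm_mul_le_of_le (norm_mul_le_of_le hYt le_rfl) (norm_mul_le_of_le hY2 hK)
  have e4 : ‖Yᵀ ^ 2 * M * (Y * K)‖ ≤ (a * D) ^ 2 * ‖M‖ * ((a * D) * κ) :=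
    norm_mul_le_of_le (norm_mul_le_of_le hYt2 le_rfl) (norm_mul_le_of_le hY hK)
  constructor
  · refine (abs_entry_le_frobenius_norm _ i j).trans ?_
    have : M * K - (M + M * Y + M * Y ^ 2) = M * (Y ^ 3 * K) := by
      rw [← hE]; noncomm_ring
    rw [this]
    refine e1.trans ?_
    have : 0 ≤ a ^ 3 * ‖M‖ * (κ ^ 2 + 2 * κ) * D ^ 3 :=
      mul_nonneg (mul_nonneg (mul_nonneg (pow_nonneg ha 3) (norm_nonneg _))
        (add_nonneg (sq_nonneg κ) (mul_nonneg zero_le_two hκ0))) (pow_nonneg hD 3)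
    linear_combination this
  · refine (abs_entry_le_frobenius_norm _ i j).trans ?_
    rw [hE2]
    refine (norm_add_le _ _).trans ?_
    refine (add_le_add_left ((norm_add_le _ _).trans (add_le_add_left (norm_add_le _ _) _)) _).trans ?_
    refine (add_le_add (add_le_add (add_le_add e2 e1) e3) e4).trans (le_of_eq ?_)
    ring

end Resolvent

/-! ### Expectations of random matrices -/

section ExpMat

variable {S : Type*} {Ω : Type*} [MeasurableSpace Ω] {μ : Measure Ω}
  {F F' : Ω → Matrix S S ℝ}

theorem expMat_add (hF : ∀ i j, Integrable (fun ω => F ω i j) μ)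
    (hF' : ∀ i j, Integrable (fun ω => F' ω i j) μ) :
    expMat μ (fun ω => F ω + F' ω) = expMat μ F + expMat μ F' := by
  ext i j
  exact integral_add (hF i j) (hF' i j)

theorem expMat_sub (hF : ∀ i j, Integrable (fun ω => F ω i j) μ)
    (hF' : ∀ i j, Integrable (fun ω => F' ω i j) μ) :
    expMat μ (fun ω => F ω - F' ω) = expMat μ F - expMat μ F' := by
  ext i j
  exact integral_sub (hF i j) (hF' i j)

theorem expMat_const [IsProbabilityMeasure μ] (M : Matrix S S ℝ) :
    expMat μ (fun _ => M) = M := by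
  ext i j
  simp [expMat]

theorem expMat_smul (c : ℝ) (F : Ω → Matrix S S ℝ) :
    expMat μ (fun ω => c • F ω) = c • expMat μ F := by
  ext i j
  exact integral_const_mul c _

theorem expMat_transpose (F : Ω → Matrix S S ℝ) :
    expMat μ (fun ω => (F ω)ᵀ) = (expMat μ F)ᵀ := rfl

variable [Fintype S]

theorem expMat_mul_left (M : Matrix S S ℝ) (hF : ∀ i j, Integrable (fun ω => F ω i j) μ) :
    expMat μ (fun ω => M * F ω) = M * expMat μ F := by
  ext i j
  simp only [expMat, of_apply, Matrix.mul_apply]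
  rw [integral_finsetSum _ fun k _ => (hF k j).const_mul _]
  simp only [integral_const_mul]

theorem expMat_mul_right (M : Matrix S S ℝ) (hF : ∀ i j, Integrable (fun ω => F ω i j) μ) :
    expMat μ (fun ω => F ω * M) = expMat μ F * M := by
  ext i j
  simp only [expMat, of_apply, Matrix.mul_apply]
  rw [integral_finsetSum _ fun k _ => (hF i k).mul_const _]
  simp only [integral_mul_const]

end ExpMat

section

variable {S : Type*} [DecidableEq S]

theorem rowCov_transpose (n : ℕ) (P : Matrix S S ℝ) (i : S) :
    (rowCov n P i)ᵀ = rowCov n P i := by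
  ext j l
  simp only [rowCov, transpose_apply, Matrix.smul_apply, Matrix.sub_apply, vecMulVec_apply,
    diagonal_apply, eq_comm (a := l) (b := j)]
  split_ifs with h
  · subst h; rfl
  · rw [mul_comm (P i l)]

end

namespace SamplingModel

section

variable {S : Type*} [Fintype S] [DecidableEq S] {Ω : Type*} [MeasurableSpace Ω]
  {μ : Measure Ω} {n : ℕ} {P : Matrix S S ℝ} {ν : S → Measure ℝ}
  {X : Ω → S → S → ℕ} {R : S → Fin n → Ω → ℝ}

section Transition

variable (hP : P ∈ Matrix.rowStochastic ℝ S)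
include hP

theorem expMat_dev (hS : SamplingModel μ n P ν X R) (hn : n ≠ 0) :
    expMat μ (fun ω => freqMat n (X ω) - P) = 0 := by
  ext i j
  exact hS.integral_dev hP hn i j

variable [IsProbabilityMeasure μ]

theorem expMat_dev_mul_mul_dev (hS : SamplingModel μ n P ν X R) (hn : n ≠ 0) (N : Matrix S S ℝ) :
    expMat μ (fun ω => (freqMat n (X ω) - P) * N * (freqMat n (X ω) - P)) =
      ∑ i, diagonal (Pi.single i (1 : ℝ)) * Nᵀ * rowCov n P i := by
  ext i l
  have h : ∀ D : Matrix S S ℝ, (D * N * D) i l = ∑ k, ∑ j, N j k * (D i j * D k l) := by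
    intro D
    simp only [Matrix.mul_apply, Finset.sum_mul]
    exact Finset.sum_congr rfl fun k _ => Finset.sum_congr rfl fun j _ => by ring
  simp only [expMat, of_apply, h]
  rw [integral_finsetSum _ fun k _ => hS.integrable_counts fun x =>
    ∑ j, N j k * ((freqMat n x - P) i j * (freqMat n x - P) k l)]
  have h2 : ∀ k, ∫ ω, ∑ j, N j k * ((freqMat n (X ω) - P) i j * (freqMat n (X ω) - P) k l) ∂μ =
      if i = k then ∑ j, N j k * rowCov n P i j l else 0 := by
    intro k
    rw [integral_finsetSum _ fun j _ => hS.integrable_counts fun x =>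
      N j k * ((freqMat n x - P) i j * (freqMat n x - P) k l)]
    simp only [integral_const_mul, hS.integral_dev_mul_dev hP hn]
    split_ifs <;> simp
  simp only [h2, Finset.sum_ite_eq, Finset.mem_univ, if_true]
  rw [Matrix.sum_apply]
  have h3 : ∀ k, (diagonal (Pi.single k (1 : ℝ)) * Nᵀ * rowCov n P k) i l =
      if i = k then ∑ j, N j k * rowCov n P k j l else 0 := by
    intro k
    rw [Matrix.mul_assoc, Matrix.diagonal_mul, Pi.single_apply]
    split_ifs with hik
    · subst hik
      simp [Matrix.mul_apply]
    · rw [zero_mul]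
  simp only [h3, Finset.sum_ite_eq, Finset.mem_univ, if_true]

theorem expMat_transpose_dev_mul_mul_dev (hS : SamplingModel μ n P ν X R) (hn : n ≠ 0)
    (M : Matrix S S ℝ) :
    expMat μ (fun ω => (freqMat n (X ω) - P)ᵀ * M * (freqMat n (X ω) - P)) =
      ∑ i, M i i • rowCov n P i := by
  ext j l
  have h : ∀ D : Matrix S S ℝ, (Dᵀ * M * D) j l = ∑ k, ∑ i, M i k * (D i j * D k l) := by
    intro D
    simp only [Matrix.mul_apply, Finset.sum_mul, transpose_apply]
    exact Finset.sum_congr rfl fun k _ => Finset.sum_congr rfl fun j _ => by ring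
  simp only [expMat, of_apply, h]
  rw [integral_finsetSum _ fun k _ => hS.integrable_counts fun x =>
    ∑ i, M i k * ((freqMat n x - P) i j * (freqMat n x - P) k l)]
  rw [Matrix.sum_apply]
  refine Finset.sum_congr rfl fun k _ => ?_
  rw [integral_finsetSum _ fun i _ => hS.integrable_counts fun x =>
    M i k * ((freqMat n x - P) i j * (freqMat n x - P) k l)]
  simp only [integral_const_mul, hS.integral_dev_mul_dev hP hn, mul_ite, mul_zero,
    Finset.sum_ite_eq', Finset.mem_univ, if_true, Matrix.smul_apply, smul_eq_mul]

variable (γ : ℝ)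

theorem expMat_matY (hS : SamplingModel μ n P ν X R) (hn : n ≠ 0) :
    expMat μ (fun ω => matY γ P (freqMat n (X ω))) = 0 := by
  simp only [matY_eq]
  rw [expMat_smul, expMat_mul_right _ fun i j => hS.integrable_counts fun x =>
    (freqMat n x - P) i j, hS.expMat_dev hP hn, Matrix.zero_mul, smul_zero]

theorem expMat_matY_sq (hS : SamplingModel μ n P ν X R) (hn : n ≠ 0) :
    expMat μ (fun ω => matY γ P (freqMat n (X ω)) ^ 2) =
      γ ^ 2 • ∑ i, diagonal (Pi.single i (1 : ℝ)) * ((sysMat γ P)⁻¹)ᵀ *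
        rowCov n P i * (sysMat γ P)⁻¹ := by
  have h : ∀ D : Matrix S S ℝ, (γ • (D * (sysMat γ P)⁻¹)) ^ 2 =
      γ ^ 2 • (D * (sysMat γ P)⁻¹ * D * (sysMat γ P)⁻¹) := by
    intro D
    rw [smul_pow, pow_two (D * _)]
    simp only [Matrix.mul_assoc]
  simp only [matY_eq, h]
  rw [expMat_smul, expMat_mul_right _ fun i j => hS.integrable_counts fun x =>
    ((freqMat n x - P) * (sysMat γ P)⁻¹ * (freqMat n x - P)) i j,
    hS.expMat_dev_mul_mul_dev hP hn, Matrix.sum_mul]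

theorem matG_eq_expMat (hS : SamplingModel μ n P ν X R) (hn : n ≠ 0) (M : Matrix S S ℝ) :
    matG n γ P M = expMat μ (fun ω =>
      (matY γ P (freqMat n (X ω)))ᵀ * M * matY γ P (freqMat n (X ω))) := by
  have h : ∀ D : Matrix S S ℝ,
      (γ • (D * (sysMat γ P)⁻¹))ᵀ * M * (γ • (D * (sysMat γ P)⁻¹)) =
      γ ^ 2 • (((sysMat γ P)⁻¹)ᵀ * (Dᵀ * M * D) * (sysMat γ P)⁻¹) := by
    intro D
    simp only [transpose_smul, transpose_mul, Matrix.smul_mul, Matrix.mul_smul, smul_smul,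
      Matrix.mul_assoc, pow_two]
  simp only [matY_eq, h]
  rw [expMat_smul, expMat_mul_right _ fun i j => hS.integrable_counts fun x =>
    (((sysMat γ P)⁻¹)ᵀ * ((freqMat n x - P)ᵀ * M * (freqMat n x - P))) i j,
    expMat_mul_left _ fun i j => hS.integrable_counts fun x =>
    ((freqMat n x - P)ᵀ * M * (freqMat n x - P)) i j,
    hS.expMat_transpose_dev_mul_mul_dev hP hn, matG]

theorem matH_eq (hS : SamplingModel μ n P ν X R) (hn : n ≠ 0) (M : Matrix S S ℝ) :
    matH n γ P M = (expMat μ (fun ω => matY γ P (freqMat n (X ω)) ^ 2))ᵀ * M +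
      M * expMat μ (fun ω => matY γ P (freqMat n (X ω)) ^ 2) := by
  rw [hS.expMat_matY_sq hP γ hn, matH, transpose_smul, transpose_sum, Matrix.smul_mul,
    Matrix.mul_smul]
  simp only [transpose_mul, diagonal_transpose, rowCov_transpose, transpose_transpose,
    Matrix.mul_assoc]

theorem matH_eq_expMat (hS : SamplingModel μ n P ν X R) (hn : n ≠ 0) (M : Matrix S S ℝ) :
    matH n γ P M = expMat μ (fun ω =>
      ((matY γ P (freqMat n (X ω)))ᵀ) ^ 2 * M + M * matY γ P (freqMat n (X ω)) ^ 2) := by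
  rw [hS.matH_eq hP γ hn, expMat_add (fun i j => hS.integrable_counts fun x =>
      (((matY γ P (freqMat n x))ᵀ) ^ 2 * M) i j) (fun i j => hS.integrable_counts fun x =>
      (M * matY γ P (freqMat n x) ^ 2) i j),
    expMat_mul_right _ (fun i j => hS.integrable_counts fun x =>
      (((matY γ P (freqMat n x))ᵀ) ^ 2) i j),
    expMat_mul_left _ (fun i j => hS.integrable_counts fun x => (matY γ P (freqMat n x) ^ 2) i j)]
  simp only [← transpose_pow]
  rw [expMat_transpose]

end Transition

end

end SamplingModel

/-! ### Moments of the estimated rewards -/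

theorem abs_covariance_le {Ω : Type*} [MeasurableSpace Ω] {μ : Measure Ω} [IsProbabilityMeasure μ]
    {U V : Ω → ℝ} (hU : MemLp U 2 μ) (hV : MemLp V 2 μ) :
    |covariance U V μ| ≤ (variance U μ + variance V μ) / 2 := by
  have hU' : MemLp (fun ω => U ω - ∫ x, U x ∂μ) 2 μ := hU.sub (memLp_const _)
  have hV' : MemLp (fun ω => V ω - ∫ x, V x ∂μ) 2 μ := hV.sub (memLp_const _)
  rw [variance_eq_integral hU.aestronglyMeasurable.aemeasurable,
    variance_eq_integral hV.aestronglyMeasurable.aemeasurable,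
    ← integral_add hU'.integrable_sq hV'.integrable_sq, ← integral_div, covariance]
  refine (abs_integral_le_integral_abs).trans (integral_mono (hU'.integrable_mul hV').abs
    ((hU'.integrable_sq.add hV'.integrable_sq).div_const 2) fun ω => ?_)
  have h := two_mul_le_add_sq |U ω - ∫ x, U x ∂μ| |V ω - ∫ x, V x ∂μ|
  rw [sq_abs, sq_abs] at h
  rw [abs_mul]
  linarith

theorem quad_eq_sum {S : Type*} [Fintype S] (Q : Matrix S S ℝ) (b : S → ℝ) :
    quad Q b = ∑ i, ∑ j, Q i j * (b i * b j) := by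
  simp only [quad, dotProduct, mulVec, Finset.mul_sum]
  exact Finset.sum_congr rfl fun i _ => Finset.sum_congr rfl fun j _ => by ring

namespace SamplingModel

section

variable {S : Type*} [Fintype S] [DecidableEq S] {Ω : Type*} [MeasurableSpace Ω]
  {μ : Measure Ω} {n : ℕ} {P : Matrix S S ℝ} {ν : S → Measure ℝ}
  {X : Ω → S → S → ℕ} {R : S → Fin n → Ω → ℝ}

theorem memLp_reward (hν2 : ∀ i, MemLp (fun x : ℝ => x) 2 (ν i))
    (hS : SamplingModel μ n P ν X R) (i : S) (k : Fin n) : MemLp (R i k) 2 μ := by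
  have h := hν2 i
  rw [← (hS.hasLaw_reward i k).map_eq, memLp_map_measure_iff
    (by fun_prop) (hS.hasLaw_reward i k).aemeasurable] at h
  exact h

theorem memLp_estB (hν2 : ∀ i, MemLp (fun x : ℝ => x) 2 (ν i))
    (hS : SamplingModel μ n P ν X R) (i : S) : MemLp (fun ω => estB n R ω i) 2 μ := by
  have h : MemLp (fun ω => (∑ k, R i k ω) * (n : ℝ)⁻¹) 2 μ :=
    (memLp_finsetSum _ fun k _ => hS.memLp_reward hν2 i k).mul_const _
  simpa only [estB, div_eq_mul_inv] using h

theorem aemeasurable_estB (hν2 : ∀ i, MemLp (fun x : ℝ => x) 2 (ν i))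
    (hS : SamplingModel μ n P ν X R) : AEMeasurable (estB n R) μ :=
  aemeasurable_pi_iff.2 fun i => (hS.memLp_estB hν2 i).aestronglyMeasurable.aemeasurable

theorem variance_estB (hν2 : ∀ i, MemLp (fun x : ℝ => x) 2 (ν i))
    (hS : SamplingModel μ n P ν X R) (hn : n ≠ 0) (i : S) :
    variance (fun ω => estB n R ω i) μ = variance id (ν i) / n := by
  have hn' : (n : ℝ) ≠ 0 := Nat.cast_ne_zero.2 hn
  have h1 : (fun ω => estB n R ω i) = fun ω => (n : ℝ)⁻¹ * (∑ k, R i k) ω := by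
    ext ω
    simp only [estB, Finset.sum_apply]
    ring
  rw [h1, variance_const_mul, IndepFun.variance_sum (fun k _ => hS.memLp_reward hν2 i k)
    (fun k _ l _ hkl => (hS.indep_reward i).indepFun hkl)]
  simp only [(hS.hasLaw_reward i _).variance_eq, Finset.sum_const, Finset.card_univ,
    Fintype.card_fin, nsmul_eq_mul]
  field_simp

theorem integral_estB [IsProbabilityMeasure μ] (hν2 : ∀ i, MemLp (fun x : ℝ => x) 2 (ν i))
    (hS : SamplingModel μ n P ν X R) (hn : n ≠ 0) (i : S) :
    ∫ ω, estB n R ω i ∂μ = meanReward ν i := by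
  have hn' : (n : ℝ) ≠ 0 := Nat.cast_ne_zero.2 hn
  simp only [estB]
  rw [integral_div, integral_finsetSum _ fun k _ => (hS.memLp_reward hν2 i k).integrable (by simp)]
  simp only [(hS.hasLaw_reward i _).integral_eq, Finset.sum_const, Finset.card_univ,
    Fintype.card_fin, nsmul_eq_mul, meanReward]
  field_simp

theorem integral_estB_mul_estB [IsProbabilityMeasure μ]
    (hν2 : ∀ i, MemLp (fun x : ℝ => x) 2 (ν i))
    (hS : SamplingModel μ n P ν X R) (hn : n ≠ 0) (i j : S) :
    ∫ ω, estB n R ω i * estB n R ω j ∂μ =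
      covMat μ (estB n R) i j + meanReward ν i * meanReward ν j := by
  have h := covariance_eq_sub (hS.memLp_estB hν2 i) (hS.memLp_estB hν2 j)
  rw [hS.integral_estB hν2 hn, hS.integral_estB hν2 hn] at h
  simp only [covMat, of_apply, h, Pi.mul_apply]
  ring

theorem abs_covMat_le [IsProbabilityMeasure μ] (hν2 : ∀ i, MemLp (fun x : ℝ => x) 2 (ν i))
    (hS : SamplingModel μ n P ν X R) (hn : n ≠ 0) (i j : S) :
    |covMat μ (estB n R) i j| ≤ (∑ k, variance id (ν k)) / n := by
  refine (abs_covariance_le (hS.memLp_estB hν2 i) (hS.memLp_estB hν2 j)).trans ?_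
  rw [hS.variance_estB hν2 hn, hS.variance_estB hν2 hn, ← add_div, div_right_comm]
  gcongr
  have h : ∀ l, variance id (ν l) ≤ ∑ k, variance id (ν k) := fun l =>
    Finset.single_le_sum (fun k _ => variance_nonneg id (ν k)) (Finset.mem_univ l)
  linarith [h i, h j]

section Joint

theorem integrable_counts_mul [IsFiniteMeasure μ] (hS : SamplingModel μ n P ν X R) (F : (S → S → ℕ) → ℝ)
    {ψ : (S → ℝ) → ℝ} (hψ : Measurable ψ) (hint : Integrable (fun ω => ψ (estB n R ω)) μ) :
    Integrable (fun ω => F (X ω) * ψ (estB n R ω)) μ :=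
  (hS.indep_transition_reward.comp (measurable_of_countable F) hψ).integrable_mul
    (hS.integrable_counts F) hint

theorem integral_counts_mul (hν2 : ∀ i, MemLp (fun x : ℝ => x) 2 (ν i))
    (hS : SamplingModel μ n P ν X R) (F : (S → S → ℕ) → ℝ)
    {ψ : (S → ℝ) → ℝ} (hψ : Measurable ψ) :
    ∫ ω, F (X ω) * ψ (estB n R ω) ∂μ = (∫ ω, F (X ω) ∂μ) * ∫ ω, ψ (estB n R ω) ∂μ :=
  hS.indep_transition_reward.integral_fun_comp_mul_comp hS.aemeasurable_counts
    (hS.aemeasurable_estB hν2) (measurable_of_countable F).aestronglyMeasurable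
    hψ.aestronglyMeasurable

variable [IsProbabilityMeasure μ] (hν2 : ∀ i, MemLp (fun x : ℝ => x) 2 (ν i))
include hν2

theorem integrable_dotProduct (hS : SamplingModel μ n P ν X R) (c : S → ℝ)
    (F : (S → S → ℕ) → Matrix S S ℝ) :
    Integrable (fun ω => c ⬝ᵥ (F (X ω) *ᵥ estB n R ω)) μ := by
  simp only [dotProduct, mulVec]
  exact integrable_finsetSum _ fun i _ => (integrable_finsetSum _ fun j _ =>
    hS.integrable_counts_mul (fun x => F x i j) (measurable_pi_apply j)
      ((hS.memLp_estB hν2 j).integrable (by simp))).const_mul _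

theorem integral_dotProduct (hS : SamplingModel μ n P ν X R) (hn : n ≠ 0) (c : S → ℝ)
    (F : (S → S → ℕ) → Matrix S S ℝ) :
    ∫ ω, c ⬝ᵥ (F (X ω) *ᵥ estB n R ω) ∂μ =
      c ⬝ᵥ (expMat μ (fun ω => F (X ω)) *ᵥ meanReward ν) := by
  have hint : ∀ i j, Integrable (fun ω => F (X ω) i j * estB n R ω j) μ := fun i j =>
    hS.integrable_counts_mul (fun x => F x i j) (measurable_pi_apply j)
      ((hS.memLp_estB hν2 j).integrable (by simp))
  simp only [dotProduct, mulVec]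
  rw [integral_finsetSum _ fun i _ => (integrable_finsetSum _ fun j _ => hint i j).const_mul _]
  refine Finset.sum_congr rfl fun i _ => ?_
  rw [integral_const_mul, integral_finsetSum _ fun j _ => hint i j]
  congr 1
  refine Finset.sum_congr rfl fun j _ => ?_
  rw [hS.integral_counts_mul hν2 (fun x => F x i j) (measurable_pi_apply j),
    hS.integral_estB hν2 hn]
  rfl

theorem integrable_quad (hS : SamplingModel μ n P ν X R) (F : (S → S → ℕ) → Matrix S S ℝ) :
    Integrable (fun ω => quad (F (X ω)) (estB n R ω)) μ := by
  simp only [quad_eq_sum]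
  exact integrable_finsetSum _ fun i _ => integrable_finsetSum _ fun j _ =>
    hS.integrable_counts_mul (fun x => F x i j)
      ((measurable_pi_apply i).mul (measurable_pi_apply j))
      ((hS.memLp_estB hν2 i).integrable_mul (hS.memLp_estB hν2 j))

theorem integral_quad (hS : SamplingModel μ n P ν X R) (hn : n ≠ 0)
    (F : (S → S → ℕ) → Matrix S S ℝ) :
    ∫ ω, quad (F (X ω)) (estB n R ω) ∂μ =
      quad (expMat μ (fun ω => F (X ω))) (meanReward ν) +
        (covMat μ (estB n R) * expMat μ (fun ω => F (X ω))).trace := by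
  have hint : ∀ i j, Integrable (fun ω => F (X ω) i j * (estB n R ω i * estB n R ω j)) μ :=
    fun i j => hS.integrable_counts_mul (fun x => F x i j)
      ((measurable_pi_apply i).mul (measurable_pi_apply j))
      ((hS.memLp_estB hν2 i).integrable_mul (hS.memLp_estB hν2 j))
  have hsymm : ∀ i j, covMat μ (estB n R) i j = covMat μ (estB n R) j i := fun i j =>
    covariance_comm _ _
  simp only [quad_eq_sum, trace, diag_apply, Matrix.mul_apply]
  rw [integral_finsetSum _ fun i _ => integrable_finsetSum _ fun j _ => hint i j,
    Finset.sum_comm (f := fun i j => covMat μ (estB n R) i j * _), ← Finset.sum_add_distrib]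
  refine Finset.sum_congr rfl fun i _ => ?_
  rw [integral_finsetSum _ fun j _ => hint i j, ← Finset.sum_add_distrib]
  refine Finset.sum_congr rfl fun j _ => ?_
  rw [hS.integral_counts_mul hν2 (fun x => F x i j) (ψ := fun f => f i * f j)
    ((measurable_pi_apply i).mul (measurable_pi_apply j)), hS.integral_estB_mul_estB hν2 hn,
    hsymm j i]
  simp only [expMat, of_apply]
  ring

end Joint

end

end SamplingModel

/-! ### Expansion of the mean square error -/

theorem rowCov_eq_smul {S : Type*} [DecidableEq S] (n : ℕ) (P : Matrix S S ℝ)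
    (i : S) :
    rowCov n P i = (1 / n : ℝ) • rowCov 1 P i := by
  simp [rowCov]

section

variable {S : Type*} [Fintype S]

theorem quad_add (Q Q' : Matrix S S ℝ) (b : S → ℝ) : quad (Q + Q') b = quad Q b + quad Q' b := by
  rw [quad, Matrix.add_mulVec, dotProduct_add]; rfl

theorem quad_sub (Q Q' : Matrix S S ℝ) (b : S → ℝ) : quad (Q - Q') b = quad Q b - quad Q' b := by
  rw [quad, Matrix.sub_mulVec, dotProduct_sub]; rfl

theorem quad_smul (c : ℝ) (Q : Matrix S S ℝ) (b : S → ℝ) : quad (c • Q) b = c * quad Q b := by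
  rw [quad, Matrix.smul_mulVec, dotProduct_smul]; rfl

theorem quad_transpose (Q : Matrix S S ℝ) (b : S → ℝ) : quad Qᵀ b = quad Q b := by
  rw [quad, Matrix.mulVec_transpose, dotProduct_comm, ← Matrix.dotProduct_mulVec]; rfl

theorem quad_conj (K M : Matrix S S ℝ) (b : S → ℝ) : quad (Kᵀ * M * K) b = quad M (K *ᵥ b) := by
  rw [quad, quad, ← Matrix.mulVec_mulVec, ← Matrix.mulVec_mulVec, Matrix.dotProduct_mulVec,
    Matrix.vecMul_transpose]

theorem quad_sub_smul {M : Matrix S S ℝ} (hM : Mᵀ = M) (b w : S → ℝ) (ε : ℝ) :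
    quad M (b - ε • w) = quad M b - 2 * ε * (b ⬝ᵥ (M *ᵥ w)) + ε ^ 2 * quad M w := by
  have h : w ⬝ᵥ (M *ᵥ b) = b ⬝ᵥ (M *ᵥ w) := by
    conv_lhs => rw [← hM, Matrix.mulVec_transpose, dotProduct_comm, ← Matrix.dotProduct_mulVec]
  simp only [quad, Matrix.mulVec_sub, Matrix.mulVec_smul, sub_dotProduct, dotProduct_sub,
    smul_dotProduct, dotProduct_smul, smul_eq_mul, h]
  ring

theorem abs_quad_le {Q : Matrix S S ℝ} {c : ℝ} (hQ : ∀ i j, |Q i j| ≤ c) (b : S → ℝ) :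
    |quad Q b| ≤ c * ∑ i, ∑ j, |b i * b j| := by
  rw [quad_eq_sum, Finset.mul_sum]
  refine (Finset.abs_sum_le_sum_abs _ _).trans (Finset.sum_le_sum fun i _ => ?_)
  rw [Finset.mul_sum]
  refine (Finset.abs_sum_le_sum_abs _ _).trans (Finset.sum_le_sum fun j _ => ?_)
  rw [abs_mul]
  exact mul_le_mul_of_nonneg_right (hQ i j) (abs_nonneg _)

theorem abs_trace_mul_le {A B : Matrix S S ℝ} {a b : ℝ} (hA : ∀ i j, |A i j| ≤ a)
    (hB : ∀ i j, |B i j| ≤ b) :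
    |(A * B).trace| ≤ (Fintype.card S : ℝ) ^ 2 * (a * b) := by
  simp only [trace, diag_apply, Matrix.mul_apply]
  calc |∑ i, ∑ j, A i j * B j i| ≤ ∑ i : S, ∑ j : S, a * b := by
        refine (Finset.abs_sum_le_sum_abs _ _).trans (Finset.sum_le_sum fun i _ => ?_)
        refine (Finset.abs_sum_le_sum_abs _ _).trans (Finset.sum_le_sum fun j _ => ?_)
        rw [abs_mul]
        exact mul_le_mul (hA i j) (hB j i) (abs_nonneg _) ((abs_nonneg _).trans (hA i j))
    _ = _ := by simp; ring

variable [DecidableEq S]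

theorem matG_eq_smul (n : ℕ) (γ : ℝ) (P M : Matrix S S ℝ) :
    matG n γ P M = (1 / n : ℝ) • matG 1 γ P M := by
  simp only [matG, rowCov_eq_smul n, smul_comm (M _ _) (1 / n : ℝ), ← Finset.smul_sum,
    Matrix.mul_smul, Matrix.smul_mul]
  rw [smul_comm]

theorem matH_eq_smul (n : ℕ) (γ : ℝ) (P M : Matrix S S ℝ) :
    matH n γ P M = (1 / n : ℝ) • matH 1 γ P M := by
  simp only [matH, rowCov_eq_smul n, ← Finset.smul_sum, Matrix.mul_smul, Matrix.smul_mul, smul_add]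
  rw [smul_comm, smul_comm (γ ^ 2) (1 / n : ℝ) (M * _)]

theorem sysMat_mulVec_valueFn_eq_resolvent (γ : ℝ) (P Q : Matrix S S ℝ) (c : S → ℝ) :
    sysMat γ P *ᵥ valueFn γ Q c = resolvent γ P Q *ᵥ c := by
  rw [valueFn, Matrix.mulVec_mulVec]; rfl

theorem sqNorm_eq_quad (γ : ℝ) (P M : Matrix S S ℝ) (x : S → ℝ) :
    sqNorm γ P M x = quad M (sysMat γ P *ᵥ x) :=
  quad_conj _ _ _

theorem loss_eq {γ : ℝ} (hγ0 : 0 < γ) (hγ1 : γ < 1) {P M : Matrix S S ℝ}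
    (hP : P ∈ Matrix.rowStochastic ℝ S) (hM : Mᵀ = M) (Q : Matrix S S ℝ) (b c : S → ℝ) (ε : ℝ) :
    loss γ P M b Q c ε = quad M b - 2 * ε * (b ⬝ᵥ ((M * resolvent γ P Q) *ᵥ c)) +
      ε ^ 2 * quad ((resolvent γ P Q)ᵀ * M * resolvent γ P Q) c := by
  rw [loss, sqNorm_eq_quad, Matrix.mulVec_sub, Matrix.mulVec_smul,
    sysMat_mulVec_valueFn hγ0 hγ1 hP, sysMat_mulVec_valueFn_eq_resolvent, quad_sub_smul hM,
    quad_conj, Matrix.mulVec_mulVec]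

end

namespace SamplingModel

section

variable {S : Type*} [Fintype S] [DecidableEq S] {Ω : Type*} [MeasurableSpace Ω]
  {μ : Measure Ω} [IsProbabilityMeasure μ] {n : ℕ} {P : Matrix S S ℝ} {ν : S → Measure ℝ}
  {X : Ω → S → S → ℕ} {R : S → Fin n → Ω → ℝ}

theorem abs_expMat_sub_le (hS : SamplingModel μ n P ν X R)
    (hP : P ∈ Matrix.rowStochastic ℝ S) (hn : n ≠ 0)
    {F : Matrix S S ℝ → Matrix S S ℝ} {c : ℝ} (hc : 0 ≤ c)
    (hF : ∀ Q ∈ Matrix.rowStochastic ℝ S, ∀ i j,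
      |F Q i j| ≤ c * (∑ q : S × S, |(Q - P) q.1 q.2|) ^ 3) (i j : S) :
    |expMat μ (fun ω => F (freqMat n (X ω))) i j| ≤
      c * (2 * (Fintype.card (S × S) : ℝ) ^ 3) * (n : ℝ) ^ (-(3 / 2 : ℝ)) := by
  calc |expMat μ (fun ω => F (freqMat n (X ω))) i j|
      ≤ ∫ ω, |F (freqMat n (X ω)) i j| ∂μ := abs_integral_le_integral_abs
    _ ≤ ∫ ω, c * absDev n P (X ω) ^ 3 ∂μ := by
        refine integral_mono_ae (hS.integrable_counts fun x => |F (freqMat n x) i j|)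
          (hS.integrable_counts fun x => c * absDev n P x ^ 3) ?_
        filter_upwards [hS.ae_freqMat_mem_rowStochastic hn] with ω hω
        exact hF _ hω i j
    _ ≤ _ := by
        rw [integral_const_mul, mul_assoc c]
        exact mul_le_mul_of_nonneg_left (hS.integral_absDev_pow_three_le hP hn) hc

theorem expMat_first_order_sub (hS : SamplingModel μ n P ν X R)
    (hP : P ∈ Matrix.rowStochastic ℝ S) (hn : n ≠ 0) (γ : ℝ) (M : Matrix S S ℝ) :
    expMat μ (fun ω => M * resolvent γ P (freqMat n (X ω)) -
        (M + M * matY γ P (freqMat n (X ω)) + M * matY γ P (freqMat n (X ω)) ^ 2)) =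
      expMat μ (fun ω => M * resolvent γ P (freqMat n (X ω))) -
        (M + M * expMat μ (fun ω => matY γ P (freqMat n (X ω)) ^ 2)) := by
  have hi : ∀ (F : Matrix S S ℝ → Matrix S S ℝ) i j,
      Integrable (fun ω => F (freqMat n (X ω)) i j) μ :=
    fun F i j => hS.integrable_counts fun x => F (freqMat n x) i j
  rw [expMat_sub (hi fun Q => M * resolvent γ P Q)
      (hi fun Q => M + M * matY γ P Q + M * matY γ P Q ^ 2),
    expMat_add (hi fun Q => M + M * matY γ P Q) (hi fun Q => M * matY γ P Q ^ 2),
    expMat_add (hi fun _ => M) (hi fun Q => M * matY γ P Q), expMat_const,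
    expMat_mul_left _ (hi fun Q => matY γ P Q), expMat_mul_left _ (hi fun Q => matY γ P Q ^ 2),
    hS.expMat_matY hP γ hn, Matrix.mul_zero, add_zero]

theorem expMat_second_order_sub (hS : SamplingModel μ n P ν X R)
    (hP : P ∈ Matrix.rowStochastic ℝ S) (hn : n ≠ 0) (γ : ℝ) (M : Matrix S S ℝ) :
    expMat μ (fun ω => (resolvent γ P (freqMat n (X ω)))ᵀ * M * resolvent γ P (freqMat n (X ω)) -
        (M + M * matY γ P (freqMat n (X ω)) + (matY γ P (freqMat n (X ω)))ᵀ * M +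
          (matY γ P (freqMat n (X ω)))ᵀ * M * matY γ P (freqMat n (X ω)) +
          ((matY γ P (freqMat n (X ω)))ᵀ ^ 2 * M + M * matY γ P (freqMat n (X ω)) ^ 2))) =
      expMat μ (fun ω => (resolvent γ P (freqMat n (X ω)))ᵀ * M *
        resolvent γ P (freqMat n (X ω))) - (M + matG n γ P M + matH n γ P M) := by
  have hi : ∀ (F : Matrix S S ℝ → Matrix S S ℝ) i j,
      Integrable (fun ω => F (freqMat n (X ω)) i j) μ :=
    fun F i j => hS.integrable_counts fun x => F (freqMat n x) i j
  rw [expMat_sub (hi fun Q => (resolvent γ P Q)ᵀ * M * resolvent γ P Q)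
      (hi fun Q => M + M * matY γ P Q + (matY γ P Q)ᵀ * M + (matY γ P Q)ᵀ * M * matY γ P Q +
        ((matY γ P Q)ᵀ ^ 2 * M + M * matY γ P Q ^ 2)),
    expMat_add (hi fun Q => M + M * matY γ P Q + (matY γ P Q)ᵀ * M +
        (matY γ P Q)ᵀ * M * matY γ P Q) (hi fun Q => (matY γ P Q)ᵀ ^ 2 * M + M * matY γ P Q ^ 2),
    expMat_add (hi fun Q => M + M * matY γ P Q + (matY γ P Q)ᵀ * M)
      (hi fun Q => (matY γ P Q)ᵀ * M * matY γ P Q),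
    expMat_add (hi fun Q => M + M * matY γ P Q) (hi fun Q => (matY γ P Q)ᵀ * M),
    expMat_add (hi fun _ => M) (hi fun Q => M * matY γ P Q), expMat_const,
    expMat_mul_left _ (hi fun Q => matY γ P Q), expMat_mul_right _ (hi fun Q => (matY γ P Q)ᵀ),
    expMat_transpose, hS.expMat_matY hP γ hn, ← hS.matG_eq_expMat hP γ hn,
    ← hS.matH_eq_expMat hP γ hn, Matrix.mul_zero, transpose_zero, Matrix.zero_mul, add_zero,
    add_zero]

variable {γ : ℝ} {M : Matrix S S ℝ} (hν2 : ∀ i, MemLp (fun x : ℝ => x) 2 (ν i))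
include hν2

theorem integral_numerator (hS : SamplingModel μ n P ν X R) (hn : n ≠ 0) (γ : ℝ)
    (M : Matrix S S ℝ) :
    ∫ ω, meanReward ν ⬝ᵥ ((M * sysMat γ P) *ᵥ valueFn γ (estP n X ω) (estB n R ω)) ∂μ =
      quad (expMat μ (fun ω => M * resolvent γ P (freqMat n (X ω)))) (meanReward ν) := by
  rw [quad, ← hS.integral_dotProduct hν2 hn (meanReward ν)
    (fun x => M * resolvent γ P (freqMat n x))]
  simp only [← Matrix.mulVec_mulVec, sysMat_mulVec_valueFn_eq_resolvent]
  rfl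

theorem integral_denominator (hS : SamplingModel μ n P ν X R) (hn : n ≠ 0) (γ : ℝ)
    (M : Matrix S S ℝ) :
    ∫ ω, sqNorm γ P M (valueFn γ (estP n X ω) (estB n R ω)) ∂μ =
      quad (expMat μ (fun ω => (resolvent γ P (freqMat n (X ω)))ᵀ * M *
        resolvent γ P (freqMat n (X ω)))) (meanReward ν) +
      (covMat μ (estB n R) * expMat μ (fun ω => (resolvent γ P (freqMat n (X ω)))ᵀ * M *
        resolvent γ P (freqMat n (X ω)))).trace := by
  rw [← hS.integral_quad hν2 hn
    (fun x => (resolvent γ P (freqMat n x))ᵀ * M * resolvent γ P (freqMat n x))]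
  simp only [sqNorm_eq_quad, sysMat_mulVec_valueFn_eq_resolvent, quad_conj]
  rfl

theorem integrable_loss (hS : SamplingModel μ n P ν X R) (hγ0 : 0 < γ) (hγ1 : γ < 1)
    (hP : P ∈ Matrix.rowStochastic ℝ S) (hM : Mᵀ = M) (b : S → ℝ) (ε : ℝ) :
    Integrable (fun ω => loss γ P M b (estP n X ω) (estB n R ω) ε) μ := by
  simp only [loss_eq hγ0 hγ1 hP hM]
  exact ((integrable_const _).sub ((hS.integrable_dotProduct hν2 b
    fun x => M * resolvent γ P (freqMat n x)).const_mul _)).add ((hS.integrable_quad hν2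
    fun x => (resolvent γ P (freqMat n x))ᵀ * M * resolvent γ P (freqMat n x)).const_mul _)

theorem MSE_eq (hS : SamplingModel μ n P ν X R) (hγ0 : 0 < γ) (hγ1 : γ < 1)
    (hP : P ∈ Matrix.rowStochastic ℝ S) (hM : Mᵀ = M) (b : S → ℝ) (ε : ℝ) :
    MSE μ γ P M b (estP n X) (estB n R) ε = quad M b -
      2 * ε * (∫ ω, b ⬝ᵥ ((M * sysMat γ P) *ᵥ valueFn γ (estP n X ω) (estB n R ω)) ∂μ) +
      ε ^ 2 * ∫ ω, sqNorm γ P M (valueFn γ (estP n X ω) (estB n R ω)) ∂μ := by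
  have h1 := hS.integrable_dotProduct hν2 b fun x => M * resolvent γ P (freqMat n x)
  have h2 := hS.integrable_quad hν2
    fun x => (resolvent γ P (freqMat n x))ᵀ * M * resolvent γ P (freqMat n x)
  simp only [← Matrix.mulVec_mulVec, sqNorm_eq_quad, sysMat_mulVec_valueFn_eq_resolvent, quad_conj]
    at h1 h2 ⊢
  simp only [MSE, loss_eq hγ0 hγ1 hP hM, ← Matrix.mulVec_mulVec, quad_conj]
  have h1' := h1.const_mul (2 * ε)
  have h2' := h2.const_mul (ε ^ 2)
  have h3 := (integrable_const (μ := μ) (quad M b)).sub h1'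
  refine (integral_add h3 h2').trans ?_
  rw [integral_const_mul]
  congr 1
  refine (integral_sub (integrable_const _) h1').trans ?_
  rw [integral_const_mul]
  rw [integral_const, probReal_univ, one_smul]
  rfl

end

end SamplingModel

/-! ### The optimal factor and its approximation -/

theorem abs_div_sub_div_le {q α α₀ β β₀ r : ℝ} (hq : 0 < q) (hα : |α - α₀| ≤ r)
    (hβ : |β - β₀| ≤ r) (hβq : q / 2 ≤ β) (hα₀ : |α₀| ≤ 3 * q / 2) (hβ₀ : q / 2 ≤ β₀) :
    |α / β - α₀ / β₀| ≤ 8 / q * r := by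
  have hβ0 : 0 < β := by linarith
  have hβ₀0 : 0 < β₀ := by linarith
  have hr : 0 ≤ r := (abs_nonneg _).trans hα
  have h : α / β - α₀ / β₀ = ((α - α₀) - α₀ / β₀ * (β - β₀)) / β := by
    field_simp
    ring
  have h1 : |α₀ / β₀| ≤ 3 := by
    rw [abs_div, abs_of_pos hβ₀0, div_le_iff₀ hβ₀0]
    linarith
  rw [h, abs_div, abs_of_pos hβ0, div_le_iff₀ hβ0]
  calc |α - α₀ - α₀ / β₀ * (β - β₀)| ≤ |α - α₀| + |α₀ / β₀ * (β - β₀)| := abs_sub _ _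
    _ ≤ r + 3 * r := by
        rw [abs_mul]
        exact add_le_add hα (mul_le_mul h1 hβ (abs_nonneg _) (by norm_num))
    _ = 8 / q * r * (q / 2) := by field_simp; ring
    _ ≤ 8 / q * r * β := mul_le_mul_of_nonneg_left hβq (by positivity)

theorem abs_quadratic_sub_le {q α α₀ β β₀ r : ℝ} (hα : |α - α₀| ≤ r) (hβ : |β - β₀| ≤ r) (ε : ℝ) :
    |(q - 2 * ε * α + ε ^ 2 * β) - (q - 2 * ε * α₀ + ε ^ 2 * β₀)| ≤ 2 * r * (1 + ε ^ 2) := by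
  have hr : 0 ≤ r := (abs_nonneg _).trans hα
  have h : (q - 2 * ε * α + ε ^ 2 * β) - (q - 2 * ε * α₀ + ε ^ 2 * β₀) =
      ε ^ 2 * (β - β₀) - 2 * ε * (α - α₀) := by ring
  rw [h]
  calc |ε ^ 2 * (β - β₀) - 2 * ε * (α - α₀)| ≤ |ε ^ 2 * (β - β₀)| + |2 * ε * (α - α₀)| :=
        abs_sub _ _
    _ = ε ^ 2 * |β - β₀| + 2 * |ε| * |α - α₀| := by
        simp [abs_mul]
    _ ≤ ε ^ 2 * r + 2 * |ε| * r := by gcongr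
    _ ≤ 2 * r * (1 + ε ^ 2) := by
        have h2 := two_mul_le_add_sq |ε| 1
        rw [sq_abs] at h2
        nlinarith

theorem quadratic_eq_add_sq {q α β : ℝ} (hβ : β ≠ 0) (ε : ℝ) :
    q - 2 * ε * α + ε ^ 2 * β =
      (q - 2 * (α / β) * α + (α / β) ^ 2 * β) + β * (ε - α / β) ^ 2 := by
  field_simp
  ring

theorem exists_first_order_bounds {S : Type*} [Fintype S] [DecidableEq S]
    (γ : ℝ) (P M : Matrix S S ℝ) (b : S → ℝ) (V : ℝ) :
    ∃ c : ℝ, 0 ≤ c ∧ ∀ n : ℕ, n ≠ 0 → ∀ Sig : Matrix S S ℝ, (∀ i j, |Sig i j| ≤ V / n) →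
      |quad (M + (1 / 2 : ℝ) • matH n γ P M) b - quad M b| ≤ c * (1 / n : ℝ) ∧
      |approxDenom n γ P M b Sig - quad M b| ≤ c * (1 / n : ℝ) := by
  set m : ℝ := ∑ q : S × S, (|M q.1 q.2| + |matG 1 γ P M q.1 q.2| + |matH 1 γ P M q.1 q.2|) with hm
  set s : ℝ := |quad (matG 1 γ P M) b| + |quad (matH 1 γ P M) b|
  have hm0 : 0 ≤ m := by positivity
  refine ⟨s + (Fintype.card S : ℝ) ^ 2 * (|V| * m), by positivity, fun n hn Sig hSig => ?_⟩
  have hn1 : (1 : ℝ) ≤ n := Nat.one_le_cast.2 (Nat.one_le_iff_ne_zero.2 hn)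
  have hd0 : 0 ≤ (1 / n : ℝ) := by positivity
  have hd1 : (1 / n : ℝ) ≤ 1 := by rw [div_le_one (by linarith)]; exact hn1
  have hG := abs_nonneg (quad (matG 1 γ P M) b)
  have hH := abs_nonneg (quad (matH 1 γ P M) b)
  constructor
  · rw [quad_add, quad_smul, matH_eq_smul, quad_smul, add_sub_cancel_left, abs_mul, abs_mul,
      abs_of_nonneg hd0, abs_of_pos (by norm_num : (0 : ℝ) < 1 / 2)]
    have h1 : |quad (matH 1 γ P M) b| ≤ s + (Fintype.card S : ℝ) ^ 2 * (|V| * m) := by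
      have : 0 ≤ (Fintype.card S : ℝ) ^ 2 * (|V| * m) := by positivity
      simp only [s]; linarith
    nlinarith [mul_le_mul_of_nonneg_right h1 hd0, mul_nonneg hH hd0]
  · have hentry : ∀ i j, |(M + matG n γ P M + matH n γ P M) i j| ≤ m := by
      intro i j
      have h1 : |M i j| + |matG 1 γ P M i j| + |matH 1 γ P M i j| ≤ m :=
        Finset.single_le_sum (f := fun q : S × S =>
          |M q.1 q.2| + |matG 1 γ P M q.1 q.2| + |matH 1 γ P M q.1 q.2|)
          (fun _ _ => by positivity) (Finset.mem_univ (i, j))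
      have h2 : ∀ Q : Matrix S S ℝ, |((1 / n : ℝ) • Q) i j| ≤ |Q i j| := fun Q => by
        rw [Matrix.smul_apply, smul_eq_mul, abs_mul, abs_of_nonneg hd0]
        exact mul_le_of_le_one_left (abs_nonneg _) hd1
      rw [matG_eq_smul n, matH_eq_smul n, Matrix.add_apply, Matrix.add_apply]
      exact (abs_add_three _ _ _).trans
        ((add_le_add (add_le_add le_rfl (h2 _)) (h2 _)).trans h1)
    have hSig' : ∀ i j, |Sig i j| ≤ |V| * (1 / n : ℝ) := fun i j => by
      rw [mul_one_div]
      exact (hSig i j).trans (by gcongr; exact le_abs_self V)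
    have ht := abs_trace_mul_le hSig' hentry
    have h3 : approxDenom n γ P M b Sig - quad M b =
        (1 / n : ℝ) * quad (matG 1 γ P M) b + (1 / n : ℝ) * quad (matH 1 γ P M) b +
          termT n γ P M Sig := by
      rw [approxDenom, quad_add, quad_add, matG_eq_smul n, matH_eq_smul n, quad_smul, quad_smul]
      ring
    rw [h3]
    refine (abs_add_three _ _ _).trans ?_
    rw [abs_mul, abs_mul, abs_of_nonneg hd0]
    refine (add_le_add le_rfl ht).trans (le_of_eq ?_)
    simp only [s]
    ring

namespace SamplingModel

theorem exists_third_order_bounds {S : Type u} [Fintype S] [DecidableEq S]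
    {γ : ℝ} (hγ0 : 0 < γ) (hγ1 : γ < 1)
    {P : Matrix S S ℝ} (hP : P ∈ Matrix.rowStochastic ℝ S)
    {ν : S → Measure ℝ} (hν2 : ∀ i, MemLp (fun x : ℝ => x) 2 (ν i))
    {M : Matrix S S ℝ} (hM : Mᵀ = M) :
    ∃ c : ℝ, 0 ≤ c ∧ ∀ n : ℕ, n ≠ 0 →
      ∀ (Ω : Type v) [MeasurableSpace Ω] (μ : Measure Ω) [IsProbabilityMeasure μ]
        (X : Ω → S → S → ℕ) (R : S → Fin n → Ω → ℝ), SamplingModel μ n P ν X R →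
      |(∫ ω, meanReward ν ⬝ᵥ ((M * sysMat γ P) *ᵥ valueFn γ (estP n X ω) (estB n R ω)) ∂μ) -
          quad (M + (1 / 2 : ℝ) • matH n γ P M) (meanReward ν)| ≤
        c * (n : ℝ) ^ (-(3 / 2 : ℝ)) ∧
      |(∫ ω, sqNorm γ P M (valueFn γ (estP n X ω) (estB n R ω)) ∂μ) -
          approxDenom n γ P M (meanReward ν) (covMat μ (estB n R))| ≤
        c * (n : ℝ) ^ (-(3 / 2 : ℝ)) := by
  obtain ⟨c, hc0, hc⟩ := exists_resolvent_bounds hγ0 hγ1 hP M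
  set c₁ : ℝ := c * (2 * (Fintype.card (S × S) : ℝ) ^ 3)
  have hc₁ : 0 ≤ c₁ := by positivity
  set s : ℝ := ∑ i, ∑ j, |meanReward ν i * meanReward ν j|
  have hs : 0 ≤ s := by positivity
  set V : ℝ := ∑ k, variance id (ν k)
  have hV : 0 ≤ V := Finset.sum_nonneg fun k _ => variance_nonneg _ _
  refine ⟨c₁ * s + (Fintype.card S : ℝ) ^ 2 * (V * c₁), by positivity, ?_⟩
  intro n hn Ω _ μ _ X R hS
  set r : ℝ := (n : ℝ) ^ (-(3 / 2 : ℝ))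
  have hr : 0 ≤ r := by positivity
  have hn1 : (1 : ℝ) ≤ n := Nat.one_le_cast.2 (Nat.one_le_iff_ne_zero.2 hn)
  have hSig : ∀ i j, |covMat μ (estB n R) i j| ≤ V := fun i j =>
    (hS.abs_covMat_le hν2 hn i j).trans (div_le_self hV hn1)
  have h1 := hS.abs_expMat_sub_le hP hn hc0
    (F := fun Q => M * resolvent γ P Q - (M + M * matY γ P Q + M * matY γ P Q ^ 2))
    fun Q hQ i j => (hc Q hQ i j).1
  have h2 := hS.abs_expMat_sub_le hP hn hc0
    (F := fun Q => (resolvent γ P Q)ᵀ * M * resolvent γ P Q -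
        (M + M * matY γ P Q + (matY γ P Q)ᵀ * M + (matY γ P Q)ᵀ * M * matY γ P Q +
          ((matY γ P Q)ᵀ ^ 2 * M + M * matY γ P Q ^ 2)))
    fun Q hQ i j => (hc Q hQ i j).2
  rw [hS.expMat_first_order_sub hP hn γ M] at h1
  rw [hS.expMat_second_order_sub hP hn γ M] at h2
  rw [hS.integral_numerator hν2 hn, hS.integral_denominator hν2 hn]
  have h0 : 0 ≤ (Fintype.card S : ℝ) ^ 2 * (V * c₁) * r := by positivity
  constructor
  · have hH : quad (M + (1 / 2 : ℝ) • matH n γ P M) (meanReward ν) =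
        quad (M + M * expMat μ (fun ω => matY γ P (freqMat n (X ω)) ^ 2)) (meanReward ν) := by
      rw [hS.matH_eq hP γ hn, quad_add, quad_add, quad_smul, quad_add]
      conv_lhs => enter [2, 2, 1]; rw [← quad_transpose, transpose_mul, hM, transpose_transpose]
      ring
    rw [hH, ← quad_sub]
    refine (abs_quad_le h1 _).trans ?_
    change c₁ * r * s ≤ _
    linarith
  · rw [approxDenom, termT, add_sub_add_comm, ← quad_sub, ← trace_sub, ← Matrix.mul_sub]
    refine (abs_add_le _ _).trans ((add_le_add (abs_quad_le h2 _)
      (abs_trace_mul_le hSig h2)).trans (le_of_eq ?_))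
    change c₁ * r * s + (Fintype.card S : ℝ) ^ 2 * (V * (c₁ * r)) = _
    ring

end SamplingModel

end OperatorAugmentation

theorem mainTheorem4 {S : Type u} [Fintype S] [DecidableEq S]
    (γ : ℝ) (hγ0 : 0 < γ) (hγ1 : γ < 1)
    (P : Matrix S S ℝ) (hP : P ∈ Matrix.rowStochastic ℝ S)
    (ν : S → Measure ℝ) (hν : ∀ i, IsProbabilityMeasure (ν i))
    (hν2 : ∀ i, MemLp (fun x : ℝ => x) 2 (ν i))
    (M : Matrix S S ℝ) (hM : M.PosDef) :
    ∃ (C : ℝ) (n₀ : ℕ), ∀ n : ℕ, n₀ ≤ n →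
      ∀ (Ω : Type v) [MeasurableSpace Ω] (μ : Measure Ω) [IsProbabilityMeasure μ]
        (X : Ω → S → S → ℕ) (R : S → Fin n → Ω → ℝ),
        OperatorAugmentation.SamplingModel μ n P ν X R →
        let b : S → ℝ := OperatorAugmentation.meanReward ν
        let Phat : Ω → Matrix S S ℝ := OperatorAugmentation.estP n X
        let bhat : Ω → S → ℝ := OperatorAugmentation.estB n R
        let Y : Ω → Matrix S S ℝ := fun ω => OperatorAugmentation.matY γ P (Phat ω)
        let MSE : ℝ → ℝ := OperatorAugmentation.MSE μ γ P M b Phat bhat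
        let Sig : Matrix S S ℝ := OperatorAugmentation.covMat μ bhat
        let G : Matrix S S ℝ := OperatorAugmentation.matG n γ P M
        let H : Matrix S S ℝ := OperatorAugmentation.matH n γ P M
        let g : ℝ := OperatorAugmentation.quad G b
        let h : ℝ := OperatorAugmentation.quad H b
        let t : ℝ := OperatorAugmentation.termT n γ P M Sig
        let εopt : ℝ := OperatorAugmentation.optFactor μ γ P M b Phat bhat
        let εapp : ℝ := OperatorAugmentation.approxFactor n γ P M b Sig
        -- the closed forms `G`, `H` are the expectations of the quadratic terms in `Y`
        G = OperatorAugmentation.expMat μ (fun ω => (Y ω)ᵀ * M * Y ω) ∧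
        H = OperatorAugmentation.expMat μ (fun ω => ((Y ω)ᵀ) ^ 2 * M + M * (Y ω) ^ 2) ∧
        -- the expansion of the mean square error, uniformly on bounded sets of `ε`
        (∀ ε : ℝ, Integrable
          (fun ω => OperatorAugmentation.loss γ P M b (Phat ω) (bhat ω) ε) μ) ∧
        (∀ ε : ℝ,
          |MSE ε - ((1 - ε) ^ 2 * OperatorAugmentation.quad M b + (g + h + t) * ε ^ 2 - h * ε)|
            ≤ C * (1 + ε ^ 2) * (n : ℝ) ^ (-(3 / 2 : ℝ))) ∧
        -- `ε*` minimizes the mean square error, uniquely if `b ≠ 0`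
        (∀ ε : ℝ, MSE εopt ≤ MSE ε) ∧
        (b ≠ 0 → ∀ ε : ℝ, ε ≠ εopt → MSE εopt < MSE ε) ∧
        -- `ε°` is well defined if `b ≠ 0`, and close to `ε*`
        (b ≠ 0 → 0 < OperatorAugmentation.approxDenom n γ P M b Sig) ∧
        |εopt - εapp| ≤ C * (n : ℝ) ^ (-(3 / 2 : ℝ)) ∧
        -- `ε°` is asymptotically as good as `ε*`
        MSE εapp ≤ MSE εopt + C * (n : ℝ) ^ (-(3 : ℝ)) := by
  open OperatorAugmentation in
  have hMt : Mᵀ = M := by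
    have := hM.isHermitian
    rwa [Matrix.IsHermitian, conjTranspose_eq_transpose_of_trivial] at this
  obtain ⟨c₁, hc₁, h₁⟩ := SamplingModel.exists_third_order_bounds.{u, v} hγ0 hγ1 hP hν2 hMt
  obtain ⟨c₂, hc₂, h₂⟩ := exists_first_order_bounds γ P M (meanReward ν)
    (∑ k, variance id (ν k))
  set q : ℝ := quad M (meanReward ν) with hq
  have hq0 : 0 ≤ q := hM.posSemidef.dotProduct_mulVec_nonneg _
  refine ⟨2 * c₁ + 8 / q * c₁ + (3 * q / 2) * (8 / q * c₁) ^ 2,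
    max 1 ⌈(c₁ + c₂) / (q / 2)⌉₊, fun n hn Ω _ μ _ X R hS => ?_⟩
  have hn1 : 1 ≤ n := (le_max_left _ _).trans hn
  have hn0 : n ≠ 0 := Nat.one_le_iff_ne_zero.1 hn1
  have hnR : (1 : ℝ) ≤ n := Nat.one_le_cast.2 hn1
  have hn2 : (c₁ + c₂) / (q / 2) ≤ n := Nat.ceil_le.1 ((le_max_right _ _).trans hn)
  intro b Phat bhat Y MSE Sig G H g h t εopt εapp
  obtain ⟨hα, hβ⟩ := h₁ n hn0 Ω μ X R hS
  obtain ⟨hα₀, hβ₀⟩ := h₂ n hn0 Sig (hS.abs_covMat_le hν2 hn0)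
  have hMSE := fun ε => hS.MSE_eq hν2 hγ0 hγ1 hP hMt b ε
  set α : ℝ := ∫ ω, b ⬝ᵥ ((M * sysMat γ P) *ᵥ valueFn γ (Phat ω) (bhat ω)) ∂μ
  set β : ℝ := ∫ ω, sqNorm γ P M (valueFn γ (Phat ω) (bhat ω)) ∂μ
  set α₀ : ℝ := quad (M + (1 / 2 : ℝ) • H) b with hα₀def
  set β₀ : ℝ := approxDenom n γ P M b Sig with hβ₀def
  set r : ℝ := (n : ℝ) ^ (-(3 / 2 : ℝ)) with hr
  have hr0 : 0 ≤ r := by positivity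
  have hr1 : r ≤ 1 / n := by
    rw [one_div, ← Real.rpow_neg_one]
    exact Real.rpow_le_rpow_of_exponent_le hnR (by norm_num)
  have hr2 : (n : ℝ) ^ (-(3 : ℝ)) = r ^ 2 := by
    rw [hr, ← Real.rpow_natCast, ← Real.rpow_mul (by positivity)]
    norm_num
  have hopt : εopt = α / β := rfl
  have happ : εapp = α₀ / β₀ := rfl
  replace hMSE : ∀ ε, MSE ε = q - 2 * ε * α + ε ^ 2 * β := hMSE
  have hC1 : 0 ≤ 8 / q * c₁ := by positivity
  have hC2 : 0 ≤ (3 * q / 2) * (8 / q * c₁) ^ 2 := by positivity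
  have hexp : ∀ ε, (1 - ε) ^ 2 * quad M b + (g + h + t) * ε ^ 2 - h * ε =
      q - 2 * ε * α₀ + ε ^ 2 * β₀ := by
    intro ε
    have e1 : α₀ = q + 1 / 2 * h := by rw [hα₀def, quad_add, quad_smul]
    have e2 : β₀ = q + g + h + t := by rw [hβ₀def, approxDenom, quad_add, quad_add]
    rw [e1, e2]
    ring
  refine ⟨hS.matG_eq_expMat hP γ hn0 M, hS.matH_eq_expMat hP γ hn0 M,
    hS.integrable_loss hν2 hγ0 hγ1 hP hMt b, fun ε => ?_, ?_⟩
  · rw [hMSE, hexp]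
    refine (abs_quadratic_sub_le hα hβ ε).trans ?_
    have : 0 ≤ (8 / q * c₁ + (3 * q / 2) * (8 / q * c₁) ^ 2) * (1 + ε ^ 2) * r := by positivity
    linarith
  rcases eq_or_ne b 0 with hb | hb
  · have hβnn : 0 ≤ β := integral_nonneg fun ω => by
      rw [sqNorm_eq_quad]
      exact hM.posSemidef.dotProduct_mulVec_nonneg _
    have hα0 : α = 0 := by simp [α, hb]
    have hα₀0 : α₀ = 0 := by simp [α₀, quad, hb]
    have hopt0 : εopt = 0 := by rw [hopt, hα0, zero_div]
    have happ0 : εapp = 0 := by rw [happ, hα₀0, zero_div]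
    refine ⟨fun ε => ?_, fun h => absurd hb h, fun h => absurd hb h, ?_, ?_⟩
    · rw [hMSE, hMSE, hopt0, hα0]
      have := mul_nonneg (sq_nonneg ε) hβnn
      linarith
    · rw [hopt0, happ0, sub_zero, abs_zero]
      positivity
    · rw [hopt0, happ0]
      exact le_add_of_nonneg_right (by positivity)
  · have hqpos : 0 < q := hM.dotProduct_mulVec_pos hb
    have hsmall : (c₁ + c₂) * (1 / n : ℝ) ≤ q / 2 := by
      rw [div_le_iff₀ (by positivity)] at hn2
      rw [mul_one_div, div_le_iff₀ (by positivity)]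
      linarith
    have hc₁r : c₁ * r ≤ c₁ * (1 / n : ℝ) := mul_le_mul_of_nonneg_left hr1 hc₁
    have hc₁n : 0 ≤ c₁ * (1 / n : ℝ) := by positivity
    have hα₀' := abs_le.1 hα₀
    have hβ₀' := abs_le.1 hβ₀
    have hβ' := abs_le.1 hβ
    have hβq : q / 2 ≤ β := by linarith
    have hβpos : 0 < β := by linarith
    have hβ₀q : q / 2 ≤ β₀ := by linarith
    have hclose : |εopt - εapp| ≤ 8 / q * (c₁ * r) :=
      abs_div_sub_div_le hqpos hα hβ hβq (abs_le.2 ⟨by linarith, by linarith⟩) hβ₀q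
    have hdiff : ∀ ε, MSE ε = MSE εopt + β * (ε - εopt) ^ 2 := by
      intro ε
      rw [hMSE, hMSE, hopt]
      exact quadratic_eq_add_sq hβpos.ne' ε
    refine ⟨fun ε => ?_, fun _ ε hε => ?_, fun _ => by linarith, ?_, ?_⟩
    · rw [hdiff ε]
      exact le_add_of_nonneg_right (by positivity)
    · rw [hdiff ε]
      have := pow_pos (abs_pos.2 (sub_ne_zero.2 hε)) 2
      rw [sq_abs] at this
      exact lt_add_of_pos_right _ (mul_pos hβpos this)
    · refine hclose.trans ?_
      have : 0 ≤ (2 * c₁ + (3 * q / 2) * (8 / q * c₁) ^ 2) * r := by positivity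
      linarith
    · rw [hdiff εapp, hr2]
      have h1 : (εapp - εopt) ^ 2 ≤ (8 / q * (c₁ * r)) ^ 2 := by
        rw [← sq_abs, abs_sub_comm]
        exact pow_le_pow_left₀ (abs_nonneg _) hclose 2
      have h2 : β * (εapp - εopt) ^ 2 ≤ (3 * q / 2) * (8 / q * (c₁ * r)) ^ 2 :=
        mul_le_mul (by linarith) h1 (sq_nonneg _) (by positivity)
      have : 0 ≤ (2 * c₁ + 8 / q * c₁) * r ^ 2 := by positivity
      linarith
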